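/- Let $M$ be a matroid on a finite ground set $E$ with set of bases $\mathcal X$, let $c:E\to\mathbb N=\{0,1,2,\dots\}$ and $b:E\to\{0,1\}$ be cost functions, and write $c(S)=\sum_{e\in S}c(e)$, $b(S)=\sum_{e\in S}b(e)$, $S+e=S\cup\{e\}$, $S-e=S\setminus\{e\}$. Elements of $E_0=\{e: b(e)=0\}$ are called green, elements of $E_1=\{e: b(e)=1\}$ red. Consider the problem $\min_{B\in\mathcal X}(c(B),b(B))$ in the Pareto sense: $B\in\mathcal X$ is efficient if no $B'\in\mathcal X$ satisfies $c(B')\le c(B)$, $b(B')\le b(B)$ and $(c(B'),b(B'))\ne(c(B),b(B))$; the non-dominated set $\mathcal Y_N$ is the set of vectors $(c(B),b(B))$ of the efficient bases $B$; a minimal complete set of efficient solutions is a set of efficient bases that contains exactly one basis for each vector of $\mathcal Y_N$. A swap with respect to a basis $B$ is a pair $(e,f)$ with $e\in E_1\cap B$, $f\in E_0\setminus B$ and $B-e+f\in\mathcal X$; its cost is $c(e,f)=c(f)-c(e)$, and it is minimal with respect to $B$ if no swap with respect to $B$ has smaller cost. Fix an indexing of the elements of $E_0$ (with distinct indices) in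 non-decreasing order of $c$. For a matroid $N$, $N-S$ denotes deletion of $S$ and $N/S$ contraction of $S$. **Procedure** $\mathrm{SSG}(N,J,U)$. If $U=\emptyset$, return no swap. If $U=\{f\}$ and $J=\{e\}$, return the swap $(e,f)$. If $|U|\ge 2$, let $U_1$ be the set of the $\lfloor |U|/2\rfloor$ elements of $U$ with the smallest indices and $U_2=U\setminus U_1$; determine $J_1\subseteq J$ such that $J_1\cup U_1$ is a basis of $N$ with $(J_1\cup U_1)\cap E_0=U_1$ and with minimal cost $c$ among all bases $B$ of $N$ with $B\cap E_0=U_1$; put $J_2=J\setminus J_1$; return the swaps returned by $\mathrm{SSG}((N-U_2)/J_1,J_2,U_1)$ together with those returned by $\mathrm{SSG}((N-J_2)/U_1,J_1,U_2)$. **Efficient Swap Algorithm.** (1) Determine a lexicographically optimal basis $B_j$, i.e. a basis that minimizes $c$ and that has the smallest $b$ among all bases minimizing $c$. (2) Among all bases $B$ that have the maximal number of green elements and satisfy $B_j\cap E_0\subseteq B$ and $B\cap E_1\subseteq B_j$, determine one, $B_u$, of minimal cost $c$. (3) Call $\mathrm{SSG}\big((M-(E\setminus(B_j\cup B_u)))/(B_j\cap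 B_u),\,B_j\setminus B_u,\,B_u\setminus B_j\big)$. (4) Sort the swaps obtained in non-decreasing order of their costs, ties being arranged by increasing index of the green elements. (5) Start with $B=B_j$, $\gamma=c(B_j)$, $\beta=b(B_j)$, $X=\{B\}$, $Y=\{(\gamma,\beta)\}$, and for each swap $(e,f)$ in the sorted order replace $B$ by $B-e+f$, $\gamma$ by $\gamma+c(e,f)$, $\beta$ by $\beta-1$, and then add $B$ to $X$ and $(\gamma,\beta)$ to $Y$. (6) Return $X$ and $Y$. **Theorem.** The algorithm is correct, whichever admissible choices are made in (1), (2) and for the sets $J_1$: every execution terminates, and every object that has to be determined in the course of it exists; the sorted list of swaps is a sequence of minimal swaps leading from $B_j$ to $B_u$, i.e. each swap is a minimal swap of $M$ with respect to the basis $B$ to which it is applied, and the last basis is $B_u$; and the returned sets are $Y=\mathcal Y_N$ and a minimal complete set $X$ of efficient solutions. -/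

import Mathlib

open scoped Matroid

/-!
Biobjective matroid problem with binary costs and the Efficient Swap Algorithm.

An instance is a finite matroid `M` on `α` with costs `c : α → ℕ` and `b : α → ℕ`, where `b`
takes the values `0` (green elements) and `1` (red elements) on the ground set. Since the ground
set is finite, every basis is (the coercion of) a `Finset`.
-/

namespace ESA

variable {α : Type*} [DecidableEq α]

/-! ### The biobjective problem -/

/-- The cost `w(B) = ∑ e ∈ B, w e` of a set of elements. -/
def cost (w : α → ℕ) (B : Finset α) : ℕ := ∑ e ∈ B, w e

/-- The green elements (binary cost `0`) of `B`. -/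
def green (b : α → ℕ) (B : Finset α) : Finset α := {e ∈ B | b e = 0}

/-- The red elements (binary cost `1`) of `B`. -/
def red (b : α → ℕ) (B : Finset α) : Finset α := {e ∈ B | b e = 1}

/-- The feasible set: all bases of `M`. -/
def bases (M : Matroid α) : Set (Finset α) := {B | M.IsBase (B : Set α)}

/-- The outcome vector `(c(B), b(B))`. -/
def outcome (c b : α → ℕ) (B : Finset α) : ℤ × ℤ := ((cost c B : ℤ), (cost b B : ℤ))

/-- Pareto dominance: componentwise `≤` and different. -/
def Dominates (y z : ℤ × ℤ) : Prop := y.1 ≤ z.1 ∧ y.2 ≤ z.2 ∧ y ≠ z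

/-- The efficient (Pareto optimal) bases. -/
def efficientSet (M : Matroid α) (c b : α → ℕ) : Set (Finset α) :=
  {B | B ∈ bases M ∧ ¬ ∃ B' ∈ bases M, Dominates (outcome c b B') (outcome c b B)}

/-- The non-dominated set: the image of the efficient set. -/
def nondominatedSet (M : Matroid α) (c b : α → ℕ) : Set (ℤ × ℤ) :=
  outcome c b '' efficientSet M c b

/-- A minimal complete set of efficient solutions: a set of efficient bases whose image is the
whole non-dominated set and which has as many members as the non-dominated set, so that it
contains exactly one efficient basis for each non-dominated outcome vector. -/
structure IsMinimalCompleteSet (M : Matroid α) (c b : α → ℕ) (X : Set (Finset α)) : Prop where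
  subset_efficient : X ⊆ efficientSet M c b
  image_eq : outcome c b '' X = nondominatedSet M c b
  card_eq : X.encard = (nondominatedSet M c b).encard

/-! ### Swaps -/

/-- The set `B - e + f`. -/
def exchange (B : Finset α) (e f : α) : Finset α := insert f (B.erase e)

/-- The cost `c(e, f) = c(f) - c(e)` of the swap `s = (e, f)`. -/
def swapCost (c : α → ℕ) (s : α × α) : ℤ := (c s.2 : ℤ) - (c s.1 : ℤ)

/-- `s = (e, f)` is a swap with respect to `B`: `e` is a red element of `B`, `f` is a green
element outside `B`, and `B - e + f` is a basis. -/
def IsSwap (M : Matroid α) (b : α → ℕ) (B : Finset α) (s : α × α) : Prop :=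
  s.1 ∈ B ∧ b s.1 = 1 ∧ s.2 ∉ B ∧ b s.2 = 0 ∧ exchange B s.1 s.2 ∈ bases M

/-- A swap of minimal cost among all swaps with respect to `B`. -/
def IsMinimalSwap (M : Matroid α) (c b : α → ℕ) (B : Finset α) (s : α × α) : Prop :=
  IsSwap M b B s ∧ ∀ t, IsSwap M b B t → swapCost c s ≤ swapCost c t

/-- Performing the swaps of the list one after the other, starting from `B`, every swap is
minimal with respect to the current basis, and the last basis is `B'`. -/
def IsSwapSequence (M : Matroid α) (c b : α → ℕ) :
    Finset α → List (α × α) → Finset α → Prop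
  | B, [], B' => B = B'
  | B, s :: S, B' => IsMinimalSwap M c b B s ∧ IsSwapSequence M c b (exchange B s.1 s.2) S B'

/-! ### Swap sequence generation -/

/-- An indexing of the green elements of `M` by non-decreasing cost `c`. -/
structure IsGreenIndexing (M : Matroid α) (c b : α → ℕ) (idx : α → ℕ) : Prop where
  injOn : Set.InjOn idx {f | f ∈ M.E ∧ b f = 0}
  sorted : ∀ f ∈ M.E, ∀ g ∈ M.E, b f = 0 → b g = 0 → idx f < idx g → c f ≤ c g

/-- The first `⌊|U| / 2⌋` elements of `U` in the order of the indices, that is, the elements of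
`U` with fewer than `⌊|U| / 2⌋` predecessors in `U`. -/
def firstHalf (idx : α → ℕ) (U : Finset α) : Finset α :=
  {f ∈ U | Finset.card {g ∈ U | idx g < idx f} < U.card / 2}

/-- `J₁ ⊆ J` is an admissible choice for `U₁`: `B = J₁ ∪ U₁` is a basis of `M` with green part
`U₁`, of minimal cost `c` among all such bases. -/
structure IsSplit (M : Matroid α) (c b : α → ℕ) (J U₁ J₁ : Finset α) : Prop where
  subset : J₁ ⊆ J
  mem_bases : J₁ ∪ U₁ ∈ bases M
  green_eq : green b (J₁ ∪ U₁) = U₁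
  minimal : ∀ B ∈ bases M, green b B = U₁ → cost c (J₁ ∪ U₁) ≤ cost c B

/-- `SSGReturns c b idx M J U T`: some execution of the recursive procedure `SSG(M, J, U)` ends
and produces the list of swaps `T`. The choice of `J₁` is nondeterministic. A call with `U = ∅`,
which occurs only if the two initial bases coincide, produces no swap. -/
inductive SSGReturns (c b idx : α → ℕ) :
    Matroid α → Finset α → Finset α → List (α × α) → Prop
  | empty (M : Matroid α) : SSGReturns c b idx M ∅ ∅ []
  | single (M : Matroid α) (e f : α) : SSGReturns c b idx M {e} {f} [(e, f)]
  | split (M : Matroid α) (J U J₁ : Finset α) (T₁ T₂ : List (α × α))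
      (hU : 2 ≤ U.card)
      (hJ₁ : IsSplit M c b J (firstHalf idx U) J₁)
      (h₁ : SSGReturns c b idx
        ((M ＼ ((U \ firstHalf idx U : Finset α) : Set α)) ／ (J₁ : Set α))
        (J \ J₁) (firstHalf idx U) T₁)
      (h₂ : SSGReturns c b idx
        ((M ＼ ((J \ J₁ : Finset α) : Set α)) ／ ((firstHalf idx U : Finset α) : Set α))
        J₁ (U \ firstHalf idx U) T₂) :
      SSGReturns c b idx M J U (T₁ ++ T₂)

/-- `SSGTerminates c b idx M J U`: every execution of `SSG(M, J, U)` ends after finitely many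
steps and never gets stuck, i.e. whenever a set `J₁` has to be determined one exists, and for
every admissible choice both recursive calls terminate in the same sense. -/
inductive SSGTerminates (c b idx : α → ℕ) : Matroid α → Finset α → Finset α → Prop
  | empty (M : Matroid α) : SSGTerminates c b idx M ∅ ∅
  | single (M : Matroid α) (e f : α) : SSGTerminates c b idx M {e} {f}
  | split (M : Matroid α) (J U : Finset α)
      (hU : 2 ≤ U.card)
      (hex : ∃ J₁, IsSplit M c b J (firstHalf idx U) J₁)
      (h₁ : ∀ J₁, IsSplit M c b J (firstHalf idx U) J₁ →
        SSGTerminates c b idx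
          ((M ＼ ((U \ firstHalf idx U : Finset α) : Set α)) ／ (J₁ : Set α))
          (J \ J₁) (firstHalf idx U))
      (h₂ : ∀ J₁, IsSplit M c b J (firstHalf idx U) J₁ →
        SSGTerminates c b idx
          ((M ＼ ((J \ J₁ : Finset α) : Set α)) ／ ((firstHalf idx U : Finset α) : Set α))
          J₁ (U \ firstHalf idx U)) :
      SSGTerminates c b idx M J U

/-! ### The Efficient Swap Algorithm -/

/-- A lexicographically optimal basis: optimal for `c`, and for `b` among the optimal ones. -/
def IsLexOptimal (M : Matroid α) (c b : α → ℕ) (B : Finset α) : Prop :=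
  B ∈ bases M ∧ ∀ B' ∈ bases M,
    cost c B < cost c B' ∨ (cost c B = cost c B' ∧ cost b B ≤ cost b B')

/-- A basis with the maximal number of green elements that contains all green elements of `Bj`
and no red elements other than those of `Bj`. -/
def IsTargetCandidate (M : Matroid α) (b : α → ℕ) (Bj B : Finset α) : Prop :=
  B ∈ bases M ∧ (∀ B' ∈ bases M, (green b B').card ≤ (green b B).card) ∧
    green b Bj ⊆ B ∧ red b B ⊆ Bj

/-- A target basis `Bu` for `Bj`: a candidate of minimal cost `c`. -/
def IsTarget (M : Matroid α) (c b : α → ℕ) (Bj Bu : Finset α) : Prop :=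
  IsTargetCandidate M b Bj Bu ∧ ∀ B, IsTargetCandidate M b Bj B → cost c Bu ≤ cost c B

/-- The reduced matroid `(M - (Bj ∪ Bu)ᶜ) / (Bj ∩ Bu)`. -/
def reduced (M : Matroid α) (Bj Bu : Finset α) : Matroid α :=
  (M ＼ (M.E \ ((Bj : Set α) ∪ (Bu : Set α)))) ／ ((Bj : Set α) ∩ (Bu : Set α))

/-- The swaps are in non-decreasing order of cost, ties being arranged by increasing index of
the green element. -/
def IsSorted (c idx : α → ℕ) (S : List (α × α)) : Prop :=
  S.Pairwise fun s t =>
    swapCost c s < swapCost c t ∨ (swapCost c s = swapCost c t ∧ idx s.2 ≤ idx t.2)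

/-- Some execution of the algorithm chooses the bases `Bj` and `Bu` and obtains the sorted list
of swaps `S`. -/
def Run (M : Matroid α) (c b idx : α → ℕ) (Bj Bu : Finset α) (S : List (α × α)) : Prop :=
  IsLexOptimal M c b Bj ∧ IsTarget M c b Bj Bu ∧
    ∃ T, SSGReturns c b idx (reduced M Bj Bu) (Bj \ Bu) (Bu \ Bj) T ∧ S.Perm T ∧ IsSorted c idx S

/-- The final loop, with the current values of `B`, `γ`, `β`, of the set of solutions and of
the set of outcome vectors. -/
def loop (c : α → ℕ) : List (α × α) → Finset α → ℤ → ℤ → Set (Finset α) → Set (ℤ × ℤ) →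
    Set (Finset α) × Set (ℤ × ℤ)
  | [], _, _, _, X, Y => (X, Y)
  | s :: S, B, γ, β, X, Y =>
      loop c S (exchange B s.1 s.2) (γ + swapCost c s) (β - 1)
        (X ∪ {exchange B s.1 s.2}) (Y ∪ {(γ + swapCost c s, β - 1)})

/-- The pair of sets computed from `Bj` and the sorted list of swaps `S`. -/
def output (c b : α → ℕ) (Bj : Finset α) (S : List (α × α)) :
    Set (Finset α) × Set (ℤ × ℤ) :=
  loop c S Bj (cost c Bj) (cost b Bj) {Bj} {((cost c Bj : ℤ), (cost b Bj : ℤ))}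

/-- Some execution of the algorithm returns the set of solutions `X` and the set of outcome
vectors `Y`. -/
def Returns (M : Matroid α) (c b idx : α → ℕ) (X : Set (Finset α)) (Y : Set (ℤ × ℤ)) : Prop :=
  ∃ Bj Bu S, Run M c b idx Bj Bu S ∧ output c b Bj S = (X, Y)

/-- Every execution of the algorithm ends after finitely many steps and never gets stuck:
all objects that have to be determined exist, whichever admissible choices were made before. -/
def Terminates (M : Matroid α) (c b idx : α → ℕ) : Prop :=
  (∃ Bj, IsLexOptimal M c b Bj) ∧ ∀ Bj, IsLexOptimal M c b Bj →
    (∃ Bu, IsTarget M c b Bj Bu) ∧ ∀ Bu, IsTarget M c b Bj Bu →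
      SSGTerminates c b idx (reduced M Bj Bu) (Bj \ Bu) (Bu \ Bj)

end ESA

/-!
The proof compares the algorithm with the scalarizations `c + l * b`. A basis is *greedy* for a
weight function if every element of the ground set is spanned by the basis elements that do not
weigh more (`IsGreedy`); greedy bases have minimal weight (`IsGreedy.sum_le`). If the current basis
is greedy for `c + l * b` and a swap of cost `l` is possible, then that swap is minimal.

All ties are removed by integer keys `k` (`exists_isKey`). They refine `c`, they order the swaps as
the algorithm does, and they prefer, among red elements of equal cost, those whose swaps occur later
in the list `T` returned by the recursion. The latter is consistent with every admissible choice of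
the sets `J₁`, because the swaps of `J₁` are listed after those of `J \ J₁`. The central result
`SSGReturns.isGreedy_stage` says that for every threshold `t`, performing exactly the swaps `(e, f)`
of `T` with `k f - k e ≤ t` yields a greedy basis for the weights in which `t` is added to the keys
of the red elements. It is proved by induction along the recursion: the union of the greedy bases of
the two minors has the size of a basis, so it suffices that each further element is spanned by
elements of the union that are not heavier and by lighter elements. In `(N - U₂) / J₁` this holds
since the contracted elements that are heavier can be dropped (`mem_closure_of_forall_notMem`), and
in `(N - J₂) / U₁` since the contracted elements are the cheapest green ones.

Back in `M`, a greedy basis of the reduced matroid together with `Bj ∩ Bu` is greedy for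
`c + l * b`, `l ≥ 0` (`IsTarget.isGreedy_union`), because `Bj` is greedy for `c`, and `Bu` is greedy
for `c + l * b` with `l` large. Hence every basis of the final loop has minimal cost among the bases
with the same value of `b`; since the costs of the swaps are positive and the last basis minimizes
`b`, the visited bases form a minimal complete set (`IsParetoChain.isMinimalCompleteSet`).
-/

namespace ESA

section GreedyBases

variable {α : Type*}

/-! ### Closure, exchange and minors -/

/-- Elements of `C` may be dropped from a set `A ∪ C` spanning `y` as long as none of them is
spanned by the rest together with `y`. -/
lemma mem_closure_of_forall_notMem {M : Matroid α} {A C : Set α} (hC : C.Finite) {y : α}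
    (hy : y ∈ M.closure (A ∪ C))
    (h : ∀ x ∈ C, x ∉ A → x ∉ M.closure (insert y ((A ∪ C) \ {x}))) : y ∈ M.closure A := by
  induction C, hC using Set.Finite.induction_on with
  | empty => simpa using hy
  | @insert x C hx _ ih =>
    have hdrop : y ∈ M.closure (A ∪ C) := by
      by_contra hcon
      by_cases hxA : x ∈ A
      · refine hcon ?_
        rwa [Set.union_insert, Set.insert_eq_of_mem (Set.mem_union_left C hxA)] at hy
      · rw [Set.union_insert] at hy
        refine h x (Set.mem_insert x C) hxA (M.closure_subset_closure ?_
          (Matroid.mem_closure_insert hcon hy))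
        refine Set.insert_subset_insert fun z hz => ⟨?_, ?_⟩
        · rcases hz with hz | hz
          · exact Or.inl hz
          · exact Or.inr (Set.mem_insert_of_mem _ hz)
        · rintro rfl
          exact hz.elim hxA hx
    refine ih hdrop fun z hz hzA hcl => h z (Set.mem_insert_of_mem _ hz) hzA ?_
    exact M.closure_subset_closure (Set.insert_subset_insert (Set.sdiff_subset_sdiff_left
      (Set.union_subset_union_right A (Set.subset_insert x C)))) hcl

/-- If `Z ⊆ B` does not span `y`, then `y` can enter the basis `B` in exchange for an element
outside `Z`. -/
lemma exists_exchange {M : Matroid α} {B Z : Set α} (hB : M.IsBase B) {y : α} (hy : y ∈ M.E)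
    (hyB : y ∉ B) (hZ : Z ⊆ B) (hyZ : y ∉ M.closure Z) :
    ∃ x ∈ B, x ∉ Z ∧ M.IsBase (insert y (B \ {x})) := by
  have hI : M.Indep (insert y Z) :=
    (((hB.indep.subset hZ).notMem_closure_iff hy).1 hyZ).1
  obtain ⟨B', hB', hIB', hB'u⟩ := hI.exists_isBase_subset_union_isBase hB
  have hyB' : y ∈ B' := hIB' (Set.mem_insert y Z)
  obtain ⟨x, hxB, hxB'⟩ : ∃ x ∈ B, x ∉ B' := by
    by_contra! hcon
    exact hyB (hB.eq_of_subset_isBase hB' hcon ▸ hyB')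
  obtain ⟨y', hy', hbase⟩ := hB.exchange hB' ⟨hxB, hxB'⟩
  have hyy : y' = y := by
    rcases hB'u hy'.1 with (h | h) | h
    · exact h
    · exact absurd (hZ h) hy'.2
    · exact absurd h hy'.2
  exact ⟨x, hxB, fun hxZ => hxB' (hIB' (Set.mem_insert_of_mem y hxZ)), hyy ▸ hbase⟩

/-- Bases of a minor whose deleted set avoids, and whose contracted set lies in, some basis. -/
lemma minor_isBase_iff {N : Matroid α} {B₀ C D X : Set α} (hB₀ : N.IsBase B₀) (hC : C ⊆ B₀)
    (hD : Disjoint B₀ D) :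
    ((N ＼ D) ／ C).IsBase X ↔ N.IsBase (X ∪ C) ∧ Disjoint X C ∧ Disjoint X D := by
  have hsub : B₀ ⊆ N.E \ D := Set.subset_sdiff.2 ⟨hB₀.subset_ground, hD⟩
  have hdel : ∀ Y, (N ＼ D).IsBase Y ↔ N.IsBase Y ∧ Disjoint Y D := by
    intro Y
    rw [Matroid.delete_isBase_iff]
    constructor
    · intro h
      exact ⟨hB₀.isBase_of_isBasis_superset hsub h, (Set.subset_sdiff.1 h.subset).2⟩
    · rintro ⟨h, hY⟩
      exact h.isBasis_of_subset Set.sdiff_subset (Set.subset_sdiff.2 ⟨h.subset_ground, hY⟩)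
  have hCi : (N ＼ D).Indep C :=
    Matroid.Indep.subset (Matroid.IsBase.indep ((hdel B₀).2 ⟨hB₀, hD⟩)) hC
  rw [hCi.contract_isBase_iff, hdel, Set.disjoint_union_left]
  have hCD : Disjoint C D := hD.mono_left hC
  tauto

lemma minor_closure_subset (N : Matroid α) (C D X : Set α) :
    ((N ＼ D) ／ C).closure X ⊆ N.closure (X ∪ C) := by
  rw [Matroid.contract_closure_eq, Matroid.delete_closure_eq]
  exact Set.sdiff_subset.trans (Set.sdiff_subset.trans (N.closure_subset_closure Set.sdiff_subset))

/-! ### Greedy bases -/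

/-- A basis is greedy for a weight function `w` if every element of the ground set is spanned by
the basis elements that do not weigh more. Greedy bases are the bases of minimal weight. -/
def IsGreedy (M : Matroid α) (w : α → ℤ) (B : Set α) : Prop :=
  M.IsBase B ∧ ∀ y ∈ M.E, y ∈ M.closure {z ∈ B | w z ≤ w y}

lemma isGreedy_of_notMem {M : Matroid α} {w : α → ℤ} {B : Set α} (hB : M.IsBase B)
    (h : ∀ y ∈ M.E, y ∉ B → y ∈ M.closure {z ∈ B | w z ≤ w y}) : IsGreedy M w B := by
  refine ⟨hB, fun y hy => ?_⟩
  by_cases hyB : y ∈ B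
  · exact M.mem_closure_of_mem' ⟨hyB, le_rfl⟩ hy
  · exact h y hy hyB

/-- A set of the size of a basis is a greedy basis if each further element is spanned by elements
of the set that do not weigh more and arbitrary lighter elements. -/
lemma isGreedy_of_lighter {M : Matroid α} {w : α → ℤ} {B B₀ : Finset α} (hE : M.E.Finite)
    (hBE : (B : Set α) ⊆ M.E) (hB₀ : M.IsBase B₀) (hcard : B.card ≤ B₀.card)
    (h : ∀ y ∈ M.E, y ∉ B →
      y ∈ M.closure ({z | z ∈ B ∧ w z ≤ w y} ∪ {z | z ∈ M.E ∧ w z < w y})) :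
    IsGreedy M w B := by
  have key : ∀ n : ℕ, ∀ y ∈ M.E, {z ∈ M.E | w z < w y}.ncard = n →
      y ∈ M.closure {z ∈ (B : Set α) | w z ≤ w y} := by
    intro n
    induction n using Nat.strong_induction_on with
    | _ n ih =>
      intro y hy hn
      by_cases hyB : y ∈ B
      · exact M.mem_closure_of_mem' ⟨hyB, le_rfl⟩ hy
      refine M.closure_subset_closure_of_subset_closure ?_ (h y hy hyB)
      rintro z (⟨hzB, hz⟩ | ⟨hzE, hz⟩)
      · exact M.mem_closure_of_mem' ⟨hzB, hz⟩ (hBE hzB)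
      · have hlt : {x ∈ M.E | w x < w z}.ncard < n := by
          have hsub : {x ∈ M.E | w x < w z} ⊆ {x ∈ M.E | w x < w y} :=
            fun x hx => ⟨hx.1, lt_trans hx.2 hz⟩
          have hss : {x ∈ M.E | w x < w z} ⊂ {x ∈ M.E | w x < w y} :=
            (Set.ssubset_iff_of_subset hsub).2 ⟨z, ⟨hzE, hz⟩, fun h => lt_irrefl _ h.2⟩
          exact hn ▸ Set.ncard_lt_ncard hss (hE.subset fun x hx => hx.1)
        have hsub : {x ∈ (B : Set α) | w x ≤ w z} ⊆ {x ∈ (B : Set α) | w x ≤ w y} :=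
          fun x hx => ⟨hx.1, le_trans hx.2 (le_of_lt hz)⟩
        exact M.closure_subset_closure hsub (ih _ hlt z hzE rfl)
  refine ⟨?_, fun y hy => key _ y hy rfl⟩
  -- The set spans and is not larger than a basis.
  have hsp : M.Spanning (B : Set α) := by
    rw [Matroid.spanning_iff_ground_subset_closure hBE]
    exact fun y hy => M.closure_subset_closure (fun z hz => hz.1) (key _ y hy rfl)
  obtain ⟨B', hB', hB'B⟩ := hsp.exists_isBase_subset
  have hn := hB'.ncard_eq_ncard_of_isBase hB₀
  rw [Set.ncard_coe_finset] at hn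
  have : B' = (B : Set α) :=
    Set.eq_of_subset_of_ncard_le hB'B (by rw [Set.ncard_coe_finset, hn]; exact hcard)
  exact this ▸ hB'

variable [DecidableEq α]

lemma coe_exchange (B : Finset α) (x y : α) :
    ((exchange B x y : Finset α) : Set α) = insert y ((B : Set α) \ {x}) := by
  simp [exchange]

lemma sum_exchange (w : α → ℤ) {B : Finset α} {x y : α} (hx : x ∈ B) (hy : y ∉ B) :
    ∑ e ∈ exchange B x y, w e = ∑ e ∈ B, w e + (w y - w x) := by
  rw [exchange, Finset.sum_insert (fun h => hy (Finset.mem_of_mem_erase h)),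
    ← Finset.add_sum_erase B w hx]
  ring

lemma IsGreedy.sum_le {M : Matroid α} {w : α → ℤ} {B : Finset α} (hB : IsGreedy M w B)
    {B' : Finset α} (hB' : M.IsBase B') : ∑ e ∈ B, w e ≤ ∑ e ∈ B', w e := by
  -- An element of `B'` outside `B` is replaced by an element of `B` that does not weigh more.
  induction hn : (B' \ B).card generalizing B' with
  | zero =>
    have hsub : B' ⊆ B := by
      rwa [Finset.card_eq_zero, Finset.sdiff_eq_empty_iff_subset] at hn
    have : B' = B := by exact_mod_cast hB'.eq_of_subset_isBase hB.1 (by exact_mod_cast hsub)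
    rw [this]
  | succ n ih =>
    obtain ⟨y, hy⟩ : (B' \ B).Nonempty := by
      rw [← Finset.card_pos]; omega
    obtain ⟨hyB', hyB⟩ := Finset.mem_sdiff.1 hy
    have hycl := hB.2 y (hB'.subset_ground hyB')
    have hyn : y ∉ M.closure ((B' : Set α) \ {y}) := hB'.indep.notMem_closure_sdiff_of_mem hyB'
    obtain ⟨z, ⟨hzB, hzw⟩, hzcl⟩ : ∃ z ∈ {z ∈ (B : Set α) | w z ≤ w y},
        z ∉ M.closure ((B' : Set α) \ {y}) := by
      by_contra! hcon
      exact hyn (M.closure_subset_closure_of_subset_closure hcon hycl)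
    have hzB' : z ∉ B' := by
      intro hz
      refine hzcl (M.mem_closure_of_mem' ⟨hz, ?_⟩ (hB.1.subset_ground hzB))
      rintro rfl
      exact hyB hzB
    have hbase : M.IsBase ((exchange B' y z : Finset α) : Set α) := by
      rw [coe_exchange]
      exact hB'.exchange_base_of_notMem_closure hyB' hzcl (hB.1.subset_ground hzB)
    have hdiff : exchange B' y z \ B = (B' \ B).erase y := by
      ext x
      simp only [exchange, Finset.mem_sdiff, Finset.mem_insert, Finset.mem_erase]
      constructor
      · rintro ⟨rfl | h, hx⟩
        · exact absurd hzB hx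
        · exact ⟨h.1, h.2, hx⟩
      · rintro ⟨h, h', hx⟩
        exact ⟨Or.inr ⟨h, h'⟩, hx⟩
    have hle := ih hbase (by rw [hdiff, Finset.card_erase_of_mem hy, hn]; rfl)
    rw [sum_exchange w hyB' hzB'] at hle
    linarith

end GreedyBases

section SwapSequenceGeneration

variable {α : Type*}

/-! ### Swap sequence generation -/

/-- The situation in which the swap sequence generation is called: the ground set consists of a
red basis `J` and a green basis `U`. -/
structure IsBasePair (b : α → ℕ) (N : Matroid α) (J U : Finset α) : Prop where
  ground_eq : N.E = (J : Set α) ∪ (U : Set α)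
  red : ∀ e ∈ J, b e = 1
  green : ∀ f ∈ U, b f = 0
  isBase_left : N.IsBase J
  isBase_right : N.IsBase U

namespace IsBasePair

variable {b : α → ℕ} {N : Matroid α} {J U : Finset α}

lemma disjoint (h : IsBasePair b N J U) : Disjoint J U := by
  rw [Finset.disjoint_left]
  intro x hx hx'
  have := h.red x hx
  have := h.green x hx'
  omega

lemma card_eq (h : IsBasePair b N J U) : J.card = U.card := by
  have := h.isBase_left.ncard_eq_ncard_of_isBase h.isBase_right
  simpa [Set.ncard_coe_finset] using this

lemma subset_union [DecidableEq α] (h : IsBasePair b N J U) {B : Finset α} (hB : N.IsBase B) :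
    B ⊆ J ∪ U := by
  have := hB.subset_ground
  rw [h.ground_eq] at this
  exact_mod_cast this

end IsBasePair

lemma firstHalf_subset (idx : α → ℕ) (U : Finset α) : firstHalf idx U ⊆ U :=
  Finset.filter_subset _ _

lemma card_firstHalf_pos {idx : α → ℕ} {U : Finset α} (hU : 2 ≤ U.card) :
    0 < (firstHalf idx U).card := by
  obtain ⟨f, hf, hmin⟩ := Finset.exists_min_image U idx (Finset.card_pos.1 (by omega))
  refine Finset.card_pos.2 ⟨f, ?_⟩
  have : {g ∈ U | idx g < idx f} = ∅ := by
    rw [Finset.filter_eq_empty_iff]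
    intro g hg
    exact not_lt.2 (hmin g hg)
  rw [firstHalf, Finset.mem_filter, this]
  refine ⟨hf, ?_⟩
  simp only [Finset.card_empty]
  omega

variable [DecidableEq α]

lemma idx_lt_of_mem_firstHalf {idx : α → ℕ} {U : Finset α} {f g : α} (hf : f ∈ firstHalf idx U)
    (hg : g ∈ U \ firstHalf idx U) : idx f < idx g := by
  simp only [firstHalf, Finset.mem_filter, Finset.mem_sdiff, not_and, not_lt] at hf hg
  by_contra! hcon
  have hle := hg.2 hg.1
  have hsub : {h ∈ U | idx h < idx g} ⊆ {h ∈ U | idx h < idx f} := by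
    intro h hh
    simp only [Finset.mem_filter] at hh ⊢
    exact ⟨hh.1, lt_of_lt_of_le hh.2 hcon⟩
  have := Finset.card_le_card hsub
  omega

lemma card_firstHalf_lt {idx : α → ℕ} {U : Finset α} (hU : 2 ≤ U.card)
    (hidx : Set.InjOn idx (U : Set α)) : (firstHalf idx U).card < U.card := by
  obtain ⟨f, hf, hmax⟩ := Finset.exists_max_image U idx (Finset.card_pos.1 (by omega))
  refine Finset.card_lt_card ((Finset.ssubset_iff_of_subset (firstHalf_subset idx U)).2 ⟨f, hf, ?_⟩)
  have : {g ∈ U | idx g < idx f} = U.erase f := by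
    ext g
    simp only [Finset.mem_filter, Finset.mem_erase]
    constructor
    · rintro ⟨hg, hlt⟩
      exact ⟨by rintro rfl; exact lt_irrefl _ hlt, hg⟩
    · rintro ⟨hne, hg⟩
      exact ⟨hg, lt_of_le_of_ne (hmax g hg) fun h => hne (hidx hg hf h)⟩
  rw [firstHalf, Finset.mem_filter, this, Finset.card_erase_of_mem hf]
  omega

section Split

variable {c b idx : α → ℕ} {N : Matroid α} {J U U₁ J₁ : Finset α}

/-- An admissible `J₁` exists: `U₁` is completed to a basis by red elements, and any basis with
green part `U₁` is of the form `J₁ ∪ U₁`. -/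
lemma IsBasePair.exists_isSplit (h : IsBasePair b N J U) (hU₁ : U₁ ⊆ U) :
    ∃ J₁, IsSplit N c b J U₁ J₁ := by
  have hI : N.Indep (U₁ : Set α) := h.isBase_right.indep.subset (by exact_mod_cast hU₁)
  obtain ⟨B, hB, hUB, hBJ⟩ := hI.exists_isBase_subset_union_isBase h.isBase_left
  have hfin : B.Finite := (U₁.finite_toSet.union J.finite_toSet).subset hBJ
  lift B to Finset α using hfin
  have hUB' : U₁ ⊆ B := by exact_mod_cast hUB
  have hBJ' : B ⊆ U₁ ∪ J := by exact_mod_cast hBJ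
  have hgreen : ESA.green b B = U₁ := by
    ext x
    simp only [ESA.green, Finset.mem_filter]
    constructor
    · rintro ⟨hx, hb⟩
      rcases Finset.mem_union.1 (hBJ' hx) with h' | h'
      · exact h'
      · have := h.red x h'
        omega
    · exact fun hx => ⟨hUB' hx, h.green x (hU₁ hx)⟩
  obtain ⟨B', ⟨hB', hg'⟩, hmin⟩ := WellFounded.has_min (measure (cost c)).wf
    {B | B ∈ bases N ∧ ESA.green b B = U₁} ⟨B, hB, hgreen⟩
  have hUB' : U₁ ⊆ B' := hg' ▸ Finset.filter_subset _ _
  have hunion : B' \ U₁ ∪ U₁ = B' := Finset.sdiff_union_of_subset hUB'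
  refine ⟨B' \ U₁, ?_, by rwa [hunion], by rwa [hunion], ?_⟩
  · intro x hx
    obtain ⟨hxB, hxU⟩ := Finset.mem_sdiff.1 hx
    rcases Finset.mem_union.1 (h.subset_union hB' hxB) with h' | h'
    · exact h'
    · exact absurd (hg' ▸ Finset.mem_filter.2 ⟨hxB, h.green x h'⟩) hxU
  · rw [hunion]
    intro B hB hBg
    exact not_lt.1 (hmin B ⟨hB, hBg⟩)

lemma IsBasePair.left_of_split (h : IsBasePair b N J U) (hU₁ : U₁ ⊆ U)
    (hs : IsSplit N c b J U₁ J₁) :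
    IsBasePair b ((N ＼ ((U \ U₁ : Finset α) : Set α)) ／ (J₁ : Set α)) (J \ J₁) U₁ := by
  have hdj := Finset.disjoint_left.1 h.disjoint
  have hJ₁ := hs.subset
  have hbase := fun X => minor_isBase_iff (X := X) (D := ((U \ U₁ : Finset α) : Set α))
    (C := (J₁ : Set α)) (N := N) (B₀ := ((J₁ ∪ U₁ : Finset α) : Set α)) hs.mem_bases
    (by exact_mod_cast Finset.subset_union_left) (by
      rw [Finset.disjoint_coe, Finset.disjoint_left]
      intro x hx hx'
      rcases Finset.mem_union.1 hx with h' | h'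
      · exact hdj (hJ₁ h') (Finset.mem_sdiff.1 hx').1
      · exact (Finset.mem_sdiff.1 hx').2 h')
  refine ⟨?_, fun e he => h.red e (Finset.mem_sdiff.1 he).1, fun f hf => h.green f (hU₁ hf), ?_, ?_⟩
  · rw [Matroid.contract_ground, Matroid.delete_ground, h.ground_eq]
    ext x
    have h1 := @hdj x
    have h2 := @hJ₁ x
    have h3 := @hU₁ x
    simp only [Set.mem_sdiff, Set.mem_union, Finset.mem_coe, Finset.mem_sdiff]
    tauto
  · rw [hbase]
    refine ⟨?_, ?_, ?_⟩
    · rw [← Finset.coe_union, Finset.sdiff_union_of_subset hJ₁]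
      exact h.isBase_left
    · rw [Finset.disjoint_coe]
      exact Finset.sdiff_disjoint
    · rw [Finset.disjoint_coe]
      exact h.disjoint.mono Finset.sdiff_subset Finset.sdiff_subset
  · rw [hbase]
    refine ⟨?_, ?_, ?_⟩
    · rw [← Finset.coe_union, Finset.union_comm]
      exact hs.mem_bases
    · rw [Finset.disjoint_coe]
      exact (h.disjoint.mono hJ₁ hU₁).symm
    · rw [Finset.disjoint_coe]
      exact Finset.disjoint_sdiff

lemma IsBasePair.right_of_split (h : IsBasePair b N J U) (hU₁ : U₁ ⊆ U)
    (hs : IsSplit N c b J U₁ J₁) :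
    IsBasePair b ((N ＼ ((J \ J₁ : Finset α) : Set α)) ／ (U₁ : Set α)) J₁ (U \ U₁) := by
  have hdj := Finset.disjoint_left.1 h.disjoint
  have hJ₁ := hs.subset
  have hbase := fun X => minor_isBase_iff (X := X) (D := ((J \ J₁ : Finset α) : Set α))
    (C := (U₁ : Set α)) (N := N) (B₀ := ((J₁ ∪ U₁ : Finset α) : Set α)) hs.mem_bases
    (by exact_mod_cast Finset.subset_union_right) (by
      rw [Finset.disjoint_coe, Finset.disjoint_left]
      intro x hx hx'
      rcases Finset.mem_union.1 hx with h' | h'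
      · exact (Finset.mem_sdiff.1 hx').2 h'
      · exact hdj (Finset.mem_sdiff.1 hx').1 (hU₁ h'))
  refine ⟨?_, fun e he => h.red e (hJ₁ he), fun f hf => h.green f (Finset.mem_sdiff.1 hf).1, ?_, ?_⟩
  · rw [Matroid.contract_ground, Matroid.delete_ground, h.ground_eq]
    ext x
    have h1 := @hdj x
    have h2 := @hJ₁ x
    have h3 := @hU₁ x
    simp only [Set.mem_sdiff, Set.mem_union, Finset.mem_coe, Finset.mem_sdiff]
    tauto
  · rw [hbase]
    refine ⟨?_, ?_, ?_⟩
    · rw [← Finset.coe_union]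
      exact hs.mem_bases
    · rw [Finset.disjoint_coe]
      exact h.disjoint.mono hJ₁ hU₁
    · rw [Finset.disjoint_coe]
      exact Finset.disjoint_sdiff
  · rw [hbase]
    refine ⟨?_, ?_, ?_⟩
    · rw [← Finset.coe_union, Finset.sdiff_union_of_subset hU₁]
      exact h.isBase_right
    · rw [Finset.disjoint_coe]
      exact Finset.sdiff_disjoint
    · rw [Finset.disjoint_coe]
      exact (h.disjoint.mono Finset.sdiff_subset Finset.sdiff_subset).symm

/-- A red element outside `J₁` is spanned by `U₁` and the elements of `J₁` that are not more
expensive, since `J₁` has minimal cost. -/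
lemma IsBasePair.mem_closure_of_split (h : IsBasePair b N J U) (hs : IsSplit N c b J U₁ J₁)
    {z : α} (hz : z ∈ J \ J₁) :
    z ∈ N.closure {x | x ∈ U₁ ∨ x ∈ J₁ ∧ c x ≤ c z} := by
  by_contra hcon
  obtain ⟨hzJ, hzJ₁⟩ := Finset.mem_sdiff.1 hz
  have hbz := h.red z hzJ
  have hzB : z ∉ J₁ ∪ U₁ := by
    intro hmem
    have : z ∈ ESA.green b (J₁ ∪ U₁) :=
      hs.green_eq.symm ▸ (Finset.mem_union.1 hmem).resolve_left hzJ₁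
    have := (Finset.mem_filter.1 this).2
    omega
  obtain ⟨x, hxB, hxZ, hbase⟩ := exists_exchange hs.mem_bases
    (h.ground_eq ▸ Or.inl hzJ) (by exact_mod_cast hzB)
    (Z := {x | x ∈ U₁ ∨ x ∈ J₁ ∧ c x ≤ c z})
    (by
      rintro x (hx | hx)
      · exact Finset.mem_coe.2 (Finset.mem_union_right _ hx)
      · exact Finset.mem_coe.2 (Finset.mem_union_left _ hx.1)) hcon
  have hxB' : x ∈ J₁ ∪ U₁ := hxB
  simp only [Set.mem_ofPred_eq, not_or, not_and, not_le] at hxZ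
  have hxJ₁ : x ∈ J₁ := (Finset.mem_union.1 hxB').resolve_right hxZ.1
  have hbx := h.red x (hs.subset hxJ₁)
  rw [← coe_exchange] at hbase
  have hgr : ESA.green b (exchange (J₁ ∪ U₁) x z) = U₁ := by
    refine Eq.trans ?_ hs.green_eq
    ext u
    simp only [ESA.green, exchange, Finset.mem_filter, Finset.mem_insert, Finset.mem_erase]
    constructor
    · rintro ⟨rfl | hu, hb⟩
      · omega
      · exact ⟨hu.2, hb⟩
    · rintro ⟨hu, hb⟩
      exact ⟨Or.inr ⟨by rintro rfl; omega, hu⟩, hb⟩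
  have hle := hs.minimal _ hbase hgr
  have hsum := sum_exchange (fun e => (c e : ℤ)) hxB' hzB
  have hlt := hxZ.2 hxJ₁
  simp only [cost] at hle
  zify at hle hlt
  linarith

end Split

theorem IsBasePair.ssgTerminates {c b idx : α → ℕ} {N : Matroid α} {J U : Finset α}
    (h : IsBasePair b N J U) (hidx : Set.InjOn idx (U : Set α)) : SSGTerminates c b idx N J U := by
  induction hn : U.card using Nat.strong_induction_on generalizing N J U with
  | _ n ih =>
    have hcard := h.card_eq
    rcases Nat.lt_or_ge U.card 2 with hlt | hU
    · obtain h0 | h1 : U.card = 0 ∨ U.card = 1 := by omega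
      · obtain rfl := Finset.card_eq_zero.1 h0
        obtain rfl := Finset.card_eq_zero.1 (hcard.trans h0)
        exact .empty N
      · obtain ⟨f, rfl⟩ := Finset.card_eq_one.1 h1
        obtain ⟨e, rfl⟩ := Finset.card_eq_one.1 (hcard.trans h1)
        exact .single N e f
    · have hsub := firstHalf_subset idx U
      have hlt := card_firstHalf_lt hU hidx
      have hpos := card_firstHalf_pos (idx := idx) hU
      refine .split N J U hU (h.exists_isSplit hsub) (fun J₁ hs => ?_) fun J₁ hs => ?_
      · exact ih _ (hn ▸ hlt) (h.left_of_split hsub hs)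
          (hidx.mono (by exact_mod_cast hsub)) rfl
      · refine ih (U \ firstHalf idx U).card ?_ (h.right_of_split hsub hs)
          (hidx.mono (by exact_mod_cast Finset.sdiff_subset)) rfl
        rw [Finset.card_sdiff_of_subset hsub]
        omega

lemma SSGTerminates.exists_returns {c b idx : α → ℕ} {N : Matroid α} {J U : Finset α}
    (h : SSGTerminates c b idx N J U) : ∃ T, SSGReturns c b idx N J U T := by
  induction h with
  | empty N => exact ⟨_, .empty N⟩
  | single N e f => exact ⟨_, .single N e f⟩
  | split N J U hU hex _ _ ih₁ ih₂ =>
    obtain ⟨J₁, hs⟩ := hex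
    obtain ⟨T₁, hT₁⟩ := ih₁ J₁ hs
    obtain ⟨T₂, hT₂⟩ := ih₂ J₁ hs
    exact ⟨_, .split N J U J₁ T₁ T₂ hU hs hT₁ hT₂⟩

lemma SSGReturns.map_fst {c b idx : α → ℕ} {N : Matroid α} {J U : Finset α} {T : List (α × α)}
    (h : SSGReturns c b idx N J U T) : ((T.map Prod.fst : List α) : Multiset α) = J.val := by
  induction h with
  | empty N => rfl
  | single N e f => rfl
  | split N J U J₁ T₁ T₂ hU hs _ _ ih₁ ih₂ =>
    rw [List.map_append, ← Multiset.coe_add, ih₁, ih₂, Finset.sdiff_val,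
      tsub_add_cancel_of_le (Finset.val_le_iff.2 hs.subset)]

lemma SSGReturns.map_snd {c b idx : α → ℕ} {N : Matroid α} {J U : Finset α} {T : List (α × α)}
    (h : SSGReturns c b idx N J U T) : ((T.map Prod.snd : List α) : Multiset α) = U.val := by
  induction h with
  | empty N => rfl
  | single N e f => rfl
  | split N J U J₁ T₁ T₂ hU hs _ _ ih₁ ih₂ =>
    rw [List.map_append, ← Multiset.coe_add, ih₁, ih₂, Finset.sdiff_val,
      add_tsub_cancel_of_le (Finset.val_le_iff.2 (firstHalf_subset idx U))]

lemma SSGReturns.fst_mem {c b idx : α → ℕ} {N : Matroid α} {J U : Finset α} {T : List (α × α)}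
    (h : SSGReturns c b idx N J U T) {e : α} : e ∈ J ↔ ∃ s ∈ T, s.1 = e := by
  rw [← Finset.mem_val, ← h.map_fst, Multiset.mem_coe, List.mem_map]

lemma SSGReturns.snd_mem {c b idx : α → ℕ} {N : Matroid α} {J U : Finset α} {T : List (α × α)}
    (h : SSGReturns c b idx N J U T) {f : α} : f ∈ U ↔ ∃ s ∈ T, s.2 = f := by
  rw [← Finset.mem_val, ← h.map_snd, Multiset.mem_coe, List.mem_map]

lemma SSGReturns.length_eq {c b idx : α → ℕ} {N : Matroid α} {J U : Finset α} {T : List (α × α)}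
    (h : SSGReturns c b idx N J U T) : T.length = J.card := by
  rw [Finset.card_def, ← h.map_fst, Multiset.coe_card, List.length_map]

/-- The weights obtained from keys `k` by adding `t + 1 / 2` to the keys of red elements, scaled
by `2`. The half excludes ties between red and green elements: a green `f` weighs less than a red
`e` if `k f - k e ≤ t`, and more otherwise. -/
def shiftedKey (b : α → ℕ) (k : α → ℤ) (t : ℤ) (y : α) : ℤ :=
  if b y = 0 then 2 * k y else 2 * k y + 2 * t + 1

/-- The set that arises from the red elements of the swaps in `T` by performing all those swaps
`(e, f)` with `k f - k e ≤ t`. -/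
def stage (k : α → ℤ) (t : ℤ) (T : List (α × α)) : Finset α :=
  (T.map fun s => if k s.2 - k s.1 ≤ t then s.2 else s.1).toFinset

/-- The keys of the red elements refine the cost `c`, and among red elements of equal cost those
of later swaps in `T` have smaller keys. -/
def RefinesRed (c : α → ℕ) (k : α → ℤ) (T : List (α × α)) : Prop :=
  T.Pairwise fun s t => (c t.1 ≤ c s.1 → k t.1 < k s.1) ∧ (c s.1 < c t.1 → k s.1 < k t.1)

/-- For every threshold `t`, performing the swaps of key at most `t` yields a greedy basis for the
weights in which red elements are shifted by `t`. In the recursive step, the greedy bases of the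
two minors combine to a greedy basis of `N`: the contracted elements of `J₁` can be dropped from a
spanning set because none of them is spanned by the rest of `J₁ ∪ U₁` and lighter elements. -/
theorem SSGReturns.isGreedy_stage {c b idx : α → ℕ} {k : α → ℤ} {N : Matroid α} {J U : Finset α}
    {T : List (α × α)} (hT : SSGReturns c b idx N J U T) (hp : IsBasePair b N J U)
    (hred : RefinesRed c k T) (hgreen : ∀ f ∈ U, ∀ g ∈ U, idx f < idx g → k f < k g) (t : ℤ) :
    IsGreedy N (shiftedKey b k t) (stage k t T) := by
  induction hT with
  | empty N => exact isGreedy_of_notMem hp.isBase_left fun y hy => by simp [hp.ground_eq] at hy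
  | single N e f =>
    have hbe : b e = 1 := hp.red e (by simp)
    have hbf : b f = 0 := hp.green f (by simp)
    by_cases hle : k f - k e ≤ t
    · have hst : stage k t [(e, f)] = {f} := by simp only [stage, List.map, if_pos hle]; rfl
      rw [hst]
      refine isGreedy_of_notMem hp.isBase_right fun y hy hyf => ?_
      rw [← hp.isBase_right.closure_eq] at hy
      have hye : y = e := by
        have := N.closure_subset_ground _ hy
        rw [hp.ground_eq] at this
        simp only [Finset.coe_singleton, Set.mem_union, Set.mem_singleton_iff] at this hyf
        tauto
      refine N.closure_subset_closure ?_ hy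
      intro z hz
      refine ⟨hz, ?_⟩
      have hzf : z = f := by simpa using hz
      subst hye hzf
      simp only [shiftedKey, hbe, hbf, if_true, one_ne_zero, if_false]
      omega
    · have hst : stage k t [(e, f)] = {e} := by simp only [stage, List.map, if_neg hle]; rfl
      rw [hst]
      refine isGreedy_of_notMem hp.isBase_left fun y hy hye => ?_
      rw [← hp.isBase_left.closure_eq] at hy
      have hyf : y = f := by
        have := N.closure_subset_ground _ hy
        rw [hp.ground_eq] at this
        simp only [Finset.coe_singleton, Set.mem_union, Set.mem_singleton_iff] at this hye
        tauto
      refine N.closure_subset_closure ?_ hy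
      intro z hz
      refine ⟨hz, ?_⟩
      have hze : z = e := by simpa using hz
      subst hyf hze
      simp only [shiftedKey, hbe, hbf, if_true, one_ne_zero, if_false]
      omega
  | split N J U J₁ T₁ T₂ hU hs h₁ h₂ ih₁ ih₂ =>
    have hsub := firstHalf_subset idx U
    have hidxlt : ∀ u ∈ firstHalf idx U, ∀ v ∈ U \ firstHalf idx U, k u < k v := fun u hu v hv =>
      hgreen u (hsub hu) v (Finset.mem_sdiff.1 hv).1 (idx_lt_of_mem_firstHalf hu hv)
    set U₁ := firstHalf idx U with hU₁
    have hp₁ := hp.left_of_split hsub hs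
    have hp₂ := hp.right_of_split hsub hs
    obtain ⟨hr₁, hr₂, hcross⟩ := List.pairwise_append.1 hred
    have hg₁ := ih₁ hp₁ hr₁ fun f hf g hg => hgreen f (hsub hf) g (hsub hg)
    have hg₂ := ih₂ hp₂ hr₂ fun f hf g hg =>
      hgreen f (Finset.mem_sdiff.1 hf).1 g (Finset.mem_sdiff.1 hg).1
    have hcross' : ∀ z ∈ J \ J₁, ∀ x ∈ J₁,
        (c x ≤ c z → k x < k z) ∧ (c z < c x → k z < k x) := by
      intro z hz x hx
      obtain ⟨s, hs, rfl⟩ := h₁.fst_mem.1 hz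
      obtain ⟨s', hs', rfl⟩ := h₂.fst_mem.1 hx
      exact hcross s hs s' hs'
    set w := shiftedKey b k t with hw
    have hwr : ∀ e ∈ J, w e = 2 * k e + 2 * t + 1 := fun e he => by
      simp [hw, shiftedKey, hp.red e he]
    have hwg : ∀ f ∈ U, w f = 2 * k f := fun f hf => by
      simp [hw, shiftedKey, hp.green f hf]
    have hst : stage k t (T₁ ++ T₂) = stage k t T₁ ∪ stage k t T₂ := by
      simp [stage, List.toFinset_append]
    have hE₁ : (stage k t T₁ : Set α) ⊆ ((J \ J₁ : Finset α) : Set α) ∪ (U₁ : Set α) :=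
      hp₁.ground_eq ▸ hg₁.1.subset_ground
    have hE₂ : (stage k t T₂ : Set α) ⊆ (J₁ : Set α) ∪ ((U \ U₁ : Finset α) : Set α) :=
      hp₂.ground_eq ▸ hg₂.1.subset_ground
    have hind := (hs.mem_bases : N.IsBase _).indep
    have hEmem : ∀ z, z ∈ J ∨ z ∈ U → z ∈ N.E := fun z hz => by
      rw [hp.ground_eq]; exact hz
    refine isGreedy_of_lighter (B₀ := J) (by rw [hp.ground_eq]; exact Set.toFinite _) ?_
      hp.isBase_left ?_ ?_
    · intro z hz
      rw [hst, Finset.coe_union] at hz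
      rcases hz with hz | hz
      · rcases hE₁ hz with hz | hz
        · exact hEmem z (Or.inl (Finset.mem_sdiff.1 hz).1)
        · exact hEmem z (Or.inr (hsub hz))
      · rcases hE₂ hz with hz | hz
        · exact hEmem z (Or.inl (hs.subset hz))
        · exact hEmem z (Or.inr (Finset.mem_sdiff.1 hz).1)
    · refine (List.toFinset_card_le _).trans ?_
      rw [List.length_map, (SSGReturns.split N J U J₁ T₁ T₂ hU hs h₁ h₂).length_eq]
    · intro y hy hyB
      rw [hst, Finset.notMem_union] at hyB
      have hycase : (y ∈ J \ J₁ ∨ y ∈ U₁) ∨ (y ∈ J₁ ∨ y ∈ U \ U₁) := by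
        rw [hp.ground_eq] at hy
        have hy' : y ∈ J ∨ y ∈ U := hy
        simp only [Finset.mem_sdiff]
        tauto
      rcases hycase with hyN | hyN
      · have hy₁ := minor_closure_subset _ _ _ _ (hg₁.2 y (by rw [hp₁.ground_eq]; exact hyN))
        -- An element of the first minor that does not weigh more than `x ∈ J₁` is spanned by
        -- `J₁ ∪ U₁` without `x`.
        have hlight : ∀ x ∈ J₁, ∀ z, z ∈ J \ J₁ ∨ z ∈ U₁ → w z ≤ w x →
            z ∈ N.closure (((J₁ ∪ U₁ : Finset α) : Set α) \ {x}) := by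
          intro x hx z hz hzx
          have hxU : x ∉ U₁ := fun hxU =>
            Finset.disjoint_left.1 hp.disjoint (hs.subset hx) (hsub hxU)
          rcases hz with hz | hz
          · have hcz : c z < c x := by
              by_contra! hcon
              have := (hcross' z hz x hx).1 hcon
              rw [hwr z (Finset.mem_sdiff.1 hz).1, hwr x (hs.subset hx)] at hzx
              omega
            refine N.closure_subset_closure ?_ (hp.mem_closure_of_split hs hz)
            rintro v (hv | hv)
            · exact ⟨Finset.mem_coe.2 (Finset.mem_union_right _ hv),
                by rintro rfl; exact hxU hv⟩
            · exact ⟨Finset.mem_coe.2 (Finset.mem_union_left _ hv.1),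
                by rintro rfl; exact absurd hv.2 (not_le.2 hcz)⟩
          · exact N.mem_closure_of_mem' ⟨Finset.mem_coe.2 (Finset.mem_union_right _ hz),
              by rintro rfl; exact hxU hz⟩ (hEmem z (Or.inr (hsub hz)))
        have hycl : y ∈ N.closure
            ({z ∈ (stage k t T₁ : Set α) | w z ≤ w y} ∪ {z | z ∈ J₁ ∧ w z < w y}) := by
          refine mem_closure_of_forall_notMem (C := (J₁ : Set α)) J₁.finite_toSet
            (N.closure_subset_closure
              (Set.union_subset_union_left _ Set.subset_union_left) hy₁) ?_
          intro x hx hxA hxcl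
          have hyx : w y ≤ w x := by
            by_contra! hcon
            exact hxA (Or.inr ⟨hx, hcon⟩)
          refine hind.notMem_closure_sdiff_of_mem
            (Finset.mem_coe.2 (Finset.mem_union_left U₁ (Finset.mem_coe.1 hx)))
            (N.closure_subset_closure_of_subset_closure ?_ hxcl)
          have hJx : ∀ z ∈ J₁, z ≠ x → z ∈ N.closure (((J₁ ∪ U₁ : Finset α) : Set α) \ {x}) :=
            fun z hz hzx => N.mem_closure_of_mem' ⟨Finset.mem_coe.2 (Finset.mem_union_left _ hz),
              hzx⟩ (hEmem z (Or.inl (hs.subset hz)))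
          rintro z (rfl | ⟨(hz | hz) | hz, hzx⟩)
          · exact hlight x hx z hyN hyx
          · exact hlight x hx z (hE₁ hz.1) (hz.2.trans hyx)
          · exact hJx z hz.1 hzx
          · exact hJx z hz hzx
        refine N.closure_subset_closure ?_ hycl
        rintro z (hz | hz)
        · exact Or.inl ⟨hst ▸ Finset.mem_union_left _ hz.1, hz.2⟩
        · exact Or.inr ⟨hEmem z (Or.inl (hs.subset hz.1)), hz.2⟩
      · have hy₂ := minor_closure_subset _ _ _ _ (hg₂.2 y (by rw [hp₂.ground_eq]; exact hyN))
        -- If some `u ∈ U₁` is not lighter than `y`, then all of `U \ U₁` is heavier than `y`, and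
        -- `y` would be spanned by the rest of the basis `J₁ ∪ U₁`.
        by_cases hall : ∀ u ∈ U₁, w u < w y
        · refine N.closure_subset_closure ?_ hy₂
          rintro z (hz | hz)
          · exact Or.inl ⟨hst ▸ Finset.mem_union_right _ hz.1, hz.2⟩
          · exact Or.inr ⟨hEmem z (Or.inr (hsub hz)), hall z hz⟩
        · exfalso
          push Not at hall
          obtain ⟨u, hu, hyu⟩ := hall
          have hv : ∀ v ∈ U \ U₁, w y < w v := fun v hv => by
            have := hidxlt u hu v hv
            rw [hwg v (Finset.mem_sdiff.1 hv).1]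
            rw [hwg u (hsub hu)] at hyu
            omega
          have hyJ : y ∈ J₁ := hyN.resolve_right fun hyU => lt_irrefl _ (hv y hyU)
          refine hind.notMem_closure_sdiff_of_mem
            (Finset.mem_coe.2 (Finset.mem_union_left U₁ hyJ)) (N.closure_subset_closure ?_ hy₂)
          rintro z (hz | hz)
          · refine ⟨?_, by rintro rfl; exact hyB.2 hz.1⟩
            rcases hE₂ hz.1 with hz' | hz'
            · exact Finset.mem_coe.2 (Finset.mem_union_left _ hz')
            · exact absurd hz.2 (not_le.2 (hv z hz'))
          · exact ⟨Finset.mem_coe.2 (Finset.mem_union_right _ hz), by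
              rintro rfl
              exact Finset.disjoint_left.1 hp.disjoint (hs.subset hyJ) (hsub hz)⟩

end SwapSequenceGeneration

section TwoExtremeBases

/-! ### Lagrangian weights -/

variable {α : Type*}

lemma IsGreedy.mono {M : Matroid α} {w w' : α → ℤ} {B : Set α} (h : IsGreedy M w B)
    (hw : ∀ z ∈ M.E, ∀ y ∈ M.E, w z ≤ w y → w' z ≤ w' y) : IsGreedy M w' B :=
  ⟨h.1, fun y hy => by
    refine M.closure_subset_closure ?_ (h.2 y hy)
    exact fun z hz => ⟨hz.1, hw z (h.1.subset_ground hz.1) y hy hz.2⟩⟩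

/-- The scalarization `c + l * b` of the two cost functions. -/
def lagrangian (c b : α → ℕ) (l : ℤ) (y : α) : ℤ := c y + l * b y

lemma sum_lagrangian (c b : α → ℕ) (l : ℤ) (B : Finset α) :
    ∑ e ∈ B, lagrangian c b l e = cost c B + l * cost b B := by
  simp [lagrangian, cost, Finset.sum_add_distrib, Finset.mul_sum]

lemma IsGreedy.lagrangian_le [DecidableEq α] {M : Matroid α} {c b : α → ℕ} {l : ℤ} {B B' : Finset α}
    (h : IsGreedy M (lagrangian c b l) B) (hB' : B' ∈ bases M) :
    (cost c B : ℤ) + l * cost b B ≤ cost c B' + l * cost b B' := by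
  rw [← sum_lagrangian, ← sum_lagrangian]
  exact h.sum_le hB'

lemma cost_exchange [DecidableEq α] (w : α → ℕ) {B : Finset α} {x y : α} (hx : x ∈ B) (hy : y ∉ B) :
    (cost w (exchange B x y) : ℤ) = cost w B + ((w y : ℤ) - w x) := by
  have := sum_exchange (fun e => (w e : ℤ)) hx hy
  simpa [cost] using this

/-! ### The initial bases -/

lemma exists_isLexOptimal (M : Matroid α) [M.Finite] (c b : α → ℕ) :
    ∃ B, IsLexOptimal M c b B := by
  obtain ⟨B₀, hB₀⟩ := M.exists_isBase
  lift B₀ to Finset α using M.set_finite B₀ hB₀.subset_ground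
  obtain ⟨B, hB, hmin⟩ := WellFounded.has_min
    (InvImage.wf (fun B => toLex (cost c B, cost b B)) (wellFounded_lt (α := ℕ ×ₗ ℕ)))
    (bases M) ⟨B₀, hB₀⟩
  refine ⟨B, hB, fun B' hB' => ?_⟩
  have := hmin B' hB'
  simp only [InvImage, Prod.Lex.toLex_lt_toLex] at this
  omega

lemma exists_isTarget (M : Matroid α) [M.Finite] {c b : α → ℕ} {Bj : Finset α}
    (hBj : Bj ∈ bases M) : ∃ Bu, IsTarget M c b Bj Bu := by
  have hgI : M.Indep (green b Bj : Set α) :=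
    (hBj : M.IsBase _).indep.subset (by exact_mod_cast Finset.filter_subset _ _)
  have hgsub : ∀ B ∈ bases M, (green b B : Set α) ⊆ {e ∈ M.E | b e = 0} := by
    intro B hB x hx
    have hx' := Finset.mem_filter.1 (Finset.mem_coe.1 hx)
    exact ⟨(hB : M.IsBase _).subset_ground hx'.1, hx'.2⟩
  -- A maximal independent set `G` of green elements that contains those of `Bj` is completed to a
  -- basis by elements of `Bj`.
  obtain ⟨G, hG, hjG⟩ := hgI.subset_isBasis_of_subset (hgsub Bj hBj) (fun x hx => hx.1)
  obtain ⟨B, hB, hGB, hBu⟩ := hG.indep.exists_isBase_subset_union_isBase hBj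
  lift B to Finset α using M.set_finite B hB.subset_ground
  have hcand : IsTargetCandidate M b Bj B := by
    refine ⟨hB, fun B' hB' => ?_, fun x hx => hGB (hjG hx), fun x hx => ?_⟩
    · have h1 : (green b B' : Set α).encard ≤ M.eRk {e ∈ M.E | b e = 0} :=
        Matroid.Indep.encard_le_eRk_of_subset ((hB' : M.IsBase _).indep.subset
          (by exact_mod_cast Finset.filter_subset _ _)) (hgsub B' hB')
      have h2 : G.encard ≤ (green b B : Set α).encard :=
        Set.encard_le_encard fun x hx =>
          Finset.mem_coe.2 (Finset.mem_filter.2 ⟨hGB hx, (hG.subset hx).2⟩)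
      rw [← hG.encard_eq_eRk] at h1
      have := h1.trans h2
      rw [Set.encard_coe_eq_coe_finsetCard, Set.encard_coe_eq_coe_finsetCard] at this
      exact_mod_cast this
    · obtain ⟨hxB, hx1⟩ := Finset.mem_filter.1 hx
      rcases hBu (Finset.mem_coe.2 hxB) with h | h
      · have := (hG.subset h).2
        omega
      · exact h
  obtain ⟨Bu, hBu, hmin⟩ := WellFounded.has_min (measure (cost c)).wf
    {B | IsTargetCandidate M b Bj B} ⟨B, hcand⟩
  exact ⟨Bu, hBu, fun B hB => not_lt.1 (hmin B hB)⟩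

section InitialBases

variable {M : Matroid α} {c b : α → ℕ} {Bj Bu : Finset α}

lemma IsTarget.subset_of_green (hu : IsTarget M c b Bj Bu) {x : α} (hx : x ∈ Bj) (hb : b x = 0) :
    x ∈ Bu :=
  hu.1.2.2.1 (Finset.mem_filter.2 ⟨hx, hb⟩)

lemma reduced_isBase_iff (hj : Bj ∈ bases M) {X : Set α} :
    (reduced M Bj Bu).IsBase X ↔ M.IsBase (X ∪ ((Bj : Set α) ∩ (Bu : Set α))) ∧
      Disjoint X ((Bj : Set α) ∩ (Bu : Set α)) ∧
      Disjoint X (M.E \ ((Bj : Set α) ∪ (Bu : Set α))) :=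
  minor_isBase_iff hj Set.inter_subset_left
    (Set.disjoint_sdiff_right.mono_left Set.subset_union_left)

variable [DecidableEq α]

lemma IsLexOptimal.mem_closure (hj : IsLexOptimal M c b Bj) {y : α} (hy : y ∈ M.E) :
    y ∈ M.closure {z | z ∈ Bj ∧ c z ≤ c y} := by
  by_cases hyB : y ∈ Bj
  · exact M.mem_closure_of_mem' ⟨hyB, le_rfl⟩ hy
  by_contra hcon
  obtain ⟨x, hxB, hxZ, hbase⟩ := exists_exchange hj.1 hy (by exact_mod_cast hyB)
    (Z := {z | z ∈ Bj ∧ c z ≤ c y}) (fun z hz => hz.1) hcon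
  rw [← coe_exchange] at hbase
  have hle : cost c Bj ≤ cost c (exchange Bj x y) := by
    rcases hj.2 _ hbase with h | h
    · exact h.le
    · exact h.1.le
  have hlt : c y < c x := by
    by_contra! h
    exact hxZ ⟨hxB, h⟩
  have := cost_exchange c (Finset.mem_coe.1 hxB) hyB
  omega

/-- The green part of the target basis is greedy among the green elements: an expensive green
element of the target outside `Bj` could be exchanged, and those in `Bj` are needed since `Bj`
has minimal cost. -/
lemma IsTarget.mem_closure_green (hj : IsLexOptimal M c b Bj) (hu : IsTarget M c b Bj Bu) {y : α}
    (hy : y ∈ M.E) (hby : b y = 0) : y ∈ M.closure {z | z ∈ Bu ∧ b z = 0 ∧ c z ≤ c y} := by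
  by_cases hyB : y ∈ Bu
  · exact M.mem_closure_of_mem' ⟨hyB, hby, le_rfl⟩ hy
  have hyj : y ∉ Bj := fun h => hyB (hu.subset_of_green h hby)
  have hcl : y ∈ M.closure ({z | z ∈ Bu ∧ b z = 0 ∧ c z ≤ c y} ∪
      {z | z ∈ Bj ∧ z ∈ Bu ∧ b z = 0}) := by
    by_contra hcon
    obtain ⟨x, hxB, hxZ, hbase⟩ := exists_exchange hu.1.1 hy (by exact_mod_cast hyB)
      (Z := {z | z ∈ Bu ∧ b z = 0 ∧ c z ≤ c y} ∪ {z | z ∈ Bj ∧ z ∈ Bu ∧ b z = 0})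
      (by rintro z (hz | hz); exacts [hz.1, hz.2.1]) hcon
    rw [← coe_exchange] at hbase
    have hxB' : x ∈ Bu := hxB
    have hgr : green b (exchange Bu x y) = insert y ((green b Bu).erase x) := by
      ext u
      simp only [green, exchange, Finset.mem_filter, Finset.mem_insert, Finset.mem_erase]
      constructor
      · rintro ⟨rfl | h, h'⟩
        · exact Or.inl rfl
        · exact Or.inr ⟨h.1, h.2, h'⟩
      · rintro (rfl | h)
        · exact ⟨Or.inl rfl, hby⟩
        · exact ⟨Or.inr ⟨h.1, h.2.1⟩, h.2.2⟩
    have hynot : y ∉ (green b Bu).erase x := fun h =>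
      hyB (Finset.mem_filter.1 (Finset.mem_of_mem_erase h)).1
    have hcard : (green b (exchange Bu x y)).card = ((green b Bu).erase x).card + 1 := by
      rw [hgr, Finset.card_insert_of_notMem hynot]
    by_cases hbx : b x = 0
    · have hxg : x ∈ green b Bu := Finset.mem_filter.2 ⟨hxB', hbx⟩
      have hxj : x ∉ Bj := fun h => hxZ (Or.inr ⟨h, hxB', hbx⟩)
      have hcx : c y < c x := by
        by_contra! h
        exact hxZ (Or.inl ⟨hxB', hbx, h⟩)
      have hcand : IsTargetCandidate M b Bj (exchange Bu x y) := by
        refine ⟨hbase, fun B' hB' => ?_, fun u hu' => ?_, fun u hu' => ?_⟩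
        · rw [hcard, Finset.card_erase_add_one hxg]
          exact hu.1.2.1 B' hB'
        · refine Finset.mem_insert_of_mem (Finset.mem_erase.2 ⟨?_, hu.1.2.2.1 hu'⟩)
          rintro rfl
          exact hxj (Finset.mem_filter.1 hu').1
        · obtain ⟨h1, h2⟩ := Finset.mem_filter.1 hu'
          rcases Finset.mem_insert.1 h1 with rfl | h
          · omega
          · exact hu.1.2.2.2 (Finset.mem_filter.2 ⟨Finset.mem_of_mem_erase h, h2⟩)
      have hle := hu.2 _ hcand
      have := cost_exchange c hxB' hyB
      omega
    · have hxg : x ∉ green b Bu := fun h => hbx (Finset.mem_filter.1 h).2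
      have := hu.1.2.1 _ hbase
      rw [hcard, Finset.erase_eq_of_notMem hxg] at this
      omega
  have hind := (hj.1 : M.IsBase _).indep
  refine mem_closure_of_forall_notMem (C := {z | z ∈ Bj ∧ z ∈ Bu ∧ b z = 0})
    (Bj.finite_toSet.subset fun z hz => hz.1) hcl fun x hx hxA hxcl => ?_
  have hcx : c y < c x := by
    by_contra! h
    exact hxA ⟨hx.2.1, hx.2.2, h⟩
  have hlight : ∀ z ∈ M.E, c z ≤ c y → z ∈ M.closure ((Bj : Set α) \ {x}) := by
    intro z hz hzy
    refine M.closure_subset_closure ?_ (hj.mem_closure hz)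
    rintro v ⟨hv, hvz⟩
    refine ⟨hv, ?_⟩
    rintro rfl
    omega
  refine hind.notMem_closure_sdiff_of_mem (Finset.mem_coe.2 hx.1)
    (M.closure_subset_closure_of_subset_closure ?_ hxcl)
  rintro z (rfl | ⟨hz | hz, hzx⟩)
  · exact hlight z hy le_rfl
  · exact hlight z ((hu.1.1 : M.IsBase _).subset_ground hz.1) hz.2.2
  · exact M.mem_closure_of_mem' ⟨hz.1, hzx⟩ ((hj.1 : M.IsBase _).subset_ground hz.1)

/-- The red part of the target basis is greedy once all its green elements are present. -/
lemma IsTarget.mem_closure (hb : ∀ e ∈ M.E, b e = 0 ∨ b e = 1) (hj : IsLexOptimal M c b Bj)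
    (hu : IsTarget M c b Bj Bu) {y : α} (hy : y ∈ M.E) :
    y ∈ M.closure {z | z ∈ Bu ∧ (b z = 0 ∨ c z ≤ c y)} := by
  have hred : ∀ z ∈ Bj, z ∈ M.closure {v | v ∈ Bu ∧ (b v = 0 ∨ c v ≤ c z)} := by
    intro z hzj
    have hzE : z ∈ M.E := (hj.1 : M.IsBase _).subset_ground hzj
    by_cases hzB : z ∈ Bu
    · exact M.mem_closure_of_mem' ⟨hzB, Or.inr le_rfl⟩ hzE
    have hbz : b z = 1 := (hb z hzE).resolve_left fun h => hzB (hu.subset_of_green hzj h)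
    by_contra hcon
    obtain ⟨x, hxB, hxZ, hbase⟩ := exists_exchange hu.1.1 hzE (by exact_mod_cast hzB)
      (Z := {v | v ∈ Bu ∧ (b v = 0 ∨ c v ≤ c z)}) (fun v hv => hv.1) hcon
    rw [← coe_exchange] at hbase
    have hxB' : x ∈ Bu := hxB
    have hx : b x ≠ 0 ∧ c z < c x := by
      constructor
      · exact fun h => hxZ ⟨hxB', Or.inl h⟩
      · by_contra! h
        exact hxZ ⟨hxB', Or.inr h⟩
    have hgr : green b (exchange Bu x z) = green b Bu := by
      ext u
      simp only [green, exchange, Finset.mem_filter, Finset.mem_insert, Finset.mem_erase]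
      constructor
      · rintro ⟨rfl | h, h'⟩
        · omega
        · exact ⟨h.2, h'⟩
      · rintro ⟨h, h'⟩
        exact ⟨Or.inr ⟨by rintro rfl; exact hx.1 h', h⟩, h'⟩
    have hcand : IsTargetCandidate M b Bj (exchange Bu x z) := by
      refine ⟨hbase, fun B' hB' => ?_, fun u hu' => ?_, fun u hu' => ?_⟩
      · rw [hgr]
        exact hu.1.2.1 B' hB'
      · refine Finset.mem_insert_of_mem (Finset.mem_erase.2 ⟨?_, hu.1.2.2.1 hu'⟩)
        rintro rfl
        exact hx.1 (Finset.mem_filter.1 hu').2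
      · obtain ⟨h1, h2⟩ := Finset.mem_filter.1 hu'
        rcases Finset.mem_insert.1 h1 with rfl | h
        · exact hzj
        · exact hu.1.2.2.2 (Finset.mem_filter.2 ⟨Finset.mem_of_mem_erase h, h2⟩)
    have hle := hu.2 _ hcand
    have := cost_exchange c hxB' hzB
    omega
  refine M.closure_subset_closure_of_subset_closure ?_ (hj.mem_closure hy)
  rintro z ⟨hzj, hzy⟩
  refine M.closure_subset_closure ?_ (hred z hzj)
  rintro v ⟨hv, hv' | hv'⟩
  · exact ⟨hv, Or.inl hv'⟩
  · exact ⟨hv, Or.inr (hv'.trans hzy)⟩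

/-- The target basis minimizes `b`, and `c` among the bases minimizing `b`: it is greedy for
`c + l * b` if `l` is large. -/
lemma IsTarget.isMin (hb : ∀ e ∈ M.E, b e = 0 ∨ b e = 1) (hj : IsLexOptimal M c b Bj)
    (hu : IsTarget M c b Bj Bu) {B : Finset α} (hB : B ∈ bases M) :
    cost b Bu ≤ cost b B ∧ (cost b B = cost b Bu → cost c Bu ≤ cost c B) := by
  set l : ℤ := cost c Bu + cost c B + 1 with hl
  have hcu : ∀ z ∈ Bu, c z ≤ cost c Bu := fun z hz =>
    Finset.single_le_sum (f := c) (fun _ _ => Nat.zero_le _) hz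
  have hg : IsGreedy M (lagrangian c b l) Bu := by
    refine ⟨hu.1.1, fun y hy => ?_⟩
    rcases hb y hy with hby | hby
    · refine M.closure_subset_closure ?_ (hu.mem_closure_green hj hy hby)
      rintro z ⟨hz, hbz, hzy⟩
      refine ⟨hz, ?_⟩
      simp only [lagrangian, hby, hbz]
      omega
    · refine M.closure_subset_closure ?_ (hu.mem_closure hb hj hy)
      rintro z ⟨hz, hzy⟩
      refine ⟨hz, ?_⟩
      have hcz := hcu z hz
      rcases hb z ((hu.1.1 : M.IsBase _).subset_ground hz) with hbz | hbz <;>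
        simp only [lagrangian, hby, hbz] <;> push_cast <;> omega
  have hle := hg.lagrangian_le hB
  constructor
  · by_contra! hlt
    have h1 : (cost b B : ℤ) + 1 ≤ cost b Bu := by exact_mod_cast hlt
    have hl0 : 0 ≤ l := by positivity
    have h2 := mul_le_mul_of_nonneg_left h1 hl0
    have : (0 : ℤ) ≤ cost c Bu := by positivity
    linarith
  · intro heq
    rw [heq] at hle
    have : (cost c Bu : ℤ) ≤ cost c B := by linarith
    exact_mod_cast this

/-! ### Lifting greedy bases from the reduced matroid -/

lemma IsTarget.isBasePair (hb : ∀ e ∈ M.E, b e = 0 ∨ b e = 1) (hj : IsLexOptimal M c b Bj)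
    (hu : IsTarget M c b Bj Bu) : IsBasePair b (reduced M Bj Bu) (Bj \ Bu) (Bu \ Bj) := by
  have hjE := (hj.1 : M.IsBase _).subset_ground
  have huE := (hu.1.1 : M.IsBase _).subset_ground
  refine ⟨?_, fun e he => ?_, fun f hf => ?_, ?_, ?_⟩
  · rw [reduced, Matroid.contract_ground, Matroid.delete_ground]
    ext x
    have h1 := @hjE x
    have h2 := @huE x
    simp only [Finset.mem_coe] at h1 h2
    simp only [Set.mem_sdiff, Set.mem_union, Set.mem_inter_iff, Finset.mem_coe, Finset.mem_sdiff]
    tauto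
  · obtain ⟨h1, h2⟩ := Finset.mem_sdiff.1 he
    exact (hb e (hjE h1)).resolve_left fun h => h2 (hu.subset_of_green h1 h)
  · obtain ⟨h1, h2⟩ := Finset.mem_sdiff.1 hf
    exact (hb f (huE h1)).resolve_right fun h =>
      h2 (hu.1.2.2.2 (Finset.mem_filter.2 ⟨h1, h⟩))
  · rw [reduced_isBase_iff hj.1]
    refine ⟨?_, ?_, ?_⟩
    · rw [Finset.coe_sdiff, Set.sdiff_union_inter]
      exact hj.1
    · rw [Finset.coe_sdiff]
      exact Set.disjoint_left.2 fun x hx hx' => hx.2 hx'.2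
    · rw [Finset.coe_sdiff]
      exact Set.disjoint_left.2 fun x hx hx' => hx'.2 (Or.inl hx.1)
  · rw [reduced_isBase_iff hj.1]
    refine ⟨?_, ?_, ?_⟩
    · rw [Finset.coe_sdiff, Set.inter_comm, Set.sdiff_union_inter]
      exact hu.1.1
    · rw [Finset.coe_sdiff]
      exact Set.disjoint_left.2 fun x hx hx' => hx.2 hx'.1
    · rw [Finset.coe_sdiff]
      exact Set.disjoint_left.2 fun x hx hx' => hx'.2 (Or.inr hx.1)

/-- A greedy basis of the reduced matroid for a scalarization `c + l * b` with `l ≥ 0` extends to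
one of `M`. The contracted elements are harmless: a red one is not spanned by the rest of `Bu` and
lighter elements, a green one not by the rest of `Bj` and lighter elements. -/
lemma IsTarget.isGreedy_union (hb : ∀ e ∈ M.E, b e = 0 ∨ b e = 1) (hj : IsLexOptimal M c b Bj)
    (hu : IsTarget M c b Bj Bu) {l : ℤ} (hl : 0 ≤ l) {S : Finset α}
    (hS : IsGreedy (reduced M Bj Bu) (lagrangian c b l) S) :
    IsGreedy M (lagrangian c b l) ((S ∪ Bj ∩ Bu : Finset α) : Set α) := by
  have hjE := (hj.1 : M.IsBase _).subset_ground
  have huE := (hu.1.1 : M.IsBase _).subset_ground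
  have hbase := ((reduced_isBase_iff hj.1).1 hS.1).1
  have hp := hu.isBasePair hb hj
  have hNE : (reduced M Bj Bu).E ⊆ M.E := by
    rw [hp.ground_eq]
    rintro x (hx | hx)
    · exact hjE (Finset.mem_sdiff.1 hx).1
    · exact huE (Finset.mem_sdiff.1 hx).1
  set w := lagrangian c b l with hw
  have hw0 : ∀ z, b z = 0 → w z = c z := fun z hz => by simp [hw, lagrangian, hz]
  have hw1 : ∀ z, b z = 1 → w z = c z + l := fun z hz => by simp [hw, lagrangian, hz]
  -- Elements lighter than a common element `x` do not need `x` to be spanned by one of the bases.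
  have hlight : ∀ x ∈ Bj, x ∈ Bu → ∃ B : Finset α, M.IsBase B ∧ Bj ∩ Bu ⊆ B ∧
      ∀ z ∈ M.E, w z < w x → z ∈ M.closure ((B : Set α) \ {x}) := by
    intro x hxj hxu
    rcases hb x (hjE hxj) with hbx | hbx
    · refine ⟨Bj, hj.1, Finset.inter_subset_left, fun z hz hzx => ?_⟩
      refine M.closure_subset_closure ?_ (hj.mem_closure hz)
      rintro v ⟨hv, hvz⟩
      refine ⟨hv, ?_⟩
      rintro rfl
      rw [hw0 v hbx] at hzx
      rcases hb z hz with h | h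
      · rw [hw0 z h] at hzx
        omega
      · rw [hw1 z h] at hzx
        omega
    · refine ⟨Bu, hu.1.1, Finset.inter_subset_right, fun z hz hzx => ?_⟩
      rw [hw1 x hbx] at hzx
      rcases hb z hz with h | h
      · refine M.closure_subset_closure ?_ (hu.mem_closure_green hj hz h)
        rintro v ⟨hv, hbv, hvz⟩
        refine ⟨hv, ?_⟩
        rintro rfl
        omega
      · refine M.closure_subset_closure ?_ (hu.mem_closure hb hj hz)
        rintro v ⟨hv, hvz⟩
        refine ⟨hv, ?_⟩
        rintro rfl
        rw [hw1 z h] at hzx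
        omega
  have hinner : ∀ y, y ∈ Bj ∨ y ∈ Bu →
      y ∈ M.closure {z ∈ ((S ∪ Bj ∩ Bu : Finset α) : Set α) | w z ≤ w y} := by
    intro y hy
    have hyE : y ∈ M.E := hy.elim (fun h => hjE h) (fun h => huE h)
    by_cases hyC : y ∈ Bj ∩ Bu
    · exact M.mem_closure_of_mem' ⟨Finset.mem_coe.2 (Finset.mem_union_right _ hyC), le_rfl⟩ hyE
    have hyN : y ∈ (reduced M Bj Bu).E := by
      rw [hp.ground_eq]
      simp only [Finset.mem_inter] at hyC
      simp only [Set.mem_union, Finset.mem_coe, Finset.mem_sdiff]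
      tauto
    have hcl := minor_closure_subset _ _ _ _ (hS.2 y hyN)
    refine mem_closure_of_forall_notMem (C := ((Bj ∩ Bu : Finset α) : Set α))
      (Finset.finite_toSet _) (M.closure_subset_closure ?_ hcl) ?_
    · rintro z (hz | hz)
      · exact Or.inl ⟨Finset.mem_coe.2 (Finset.mem_union_left _ hz.1), hz.2⟩
      · exact Or.inr (by rw [Finset.coe_inter]; exact hz)
    · intro x hx hxA hxcl
      have hxC : x ∈ Bj ∩ Bu := hx
      have hyx : w y < w x := by
        by_contra! h
        exact hxA ⟨Finset.mem_coe.2 (Finset.mem_union_right _ hxC), h⟩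
      obtain ⟨B, hB, hCB, hBl⟩ := hlight x (Finset.mem_inter.1 hxC).1 (Finset.mem_inter.1 hxC).2
      refine hB.indep.notMem_closure_sdiff_of_mem (Finset.mem_coe.2 (hCB hxC))
        (M.closure_subset_closure_of_subset_closure ?_ hxcl)
      rintro z (rfl | ⟨hz | hz, hzx⟩)
      · exact hBl z hyE hyx
      · refine hBl z (hbase.subset_ground ?_) (lt_of_le_of_lt hz.2 hyx)
        rw [← Finset.coe_inter, ← Finset.coe_union]
        exact hz.1
      · exact M.mem_closure_of_mem' ⟨hCB hz, hzx⟩ (hB.subset_ground (hCB hz))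
  refine ⟨by rw [Finset.coe_union, Finset.coe_inter]; exact hbase, fun y hy => ?_⟩
  rcases hb y hy with hby | hby
  · refine M.closure_subset_closure_of_subset_closure ?_ (hu.mem_closure_green hj hy hby)
    rintro z ⟨hz, hbz, hzy⟩
    have hle : w z ≤ w y := by
      rw [hw0 z hbz, hw0 y hby]
      exact_mod_cast hzy
    refine M.closure_subset_closure ?_ (hinner z (Or.inr hz))
    exact fun v hv => ⟨hv.1, le_trans hv.2 hle⟩
  · refine M.closure_subset_closure_of_subset_closure ?_ (hj.mem_closure hy)
    rintro z ⟨hz, hzy⟩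
    have hle : w z ≤ w y := by
      rw [hw1 y hby]
      rcases hb z (hjE hz) with h | h
      · rw [hw0 z h]
        omega
      · rw [hw1 z h]
        omega
    refine M.closure_subset_closure ?_ (hinner z (Or.inl hz))
    exact fun v hv => ⟨hv.1, le_trans hv.2 hle⟩

end InitialBases

end TwoExtremeBases

section BasisSequence

variable {α : Type*} [DecidableEq α]

/-! ### Keys without ties -/

/-- Integer keys that refine the cost `c` and break all ties in the way the algorithm does: the
difference of the keys of a green and a red element orders the swaps by cost and then by the index
of the green element, and red elements of equal cost are ordered by their position in `T`. -/
structure IsKey (c idx : α → ℕ) (k : α → ℤ) (J U : Finset α) (T : List (α × α)) : Prop where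
  refinesRed : RefinesRed c k T
  green_lt : ∀ f ∈ U, ∀ g ∈ U, idx f < idx g → k f < k g
  green_le : ∀ f ∈ U, ∀ g ∈ U, k f ≤ k g → c f ≤ c g
  red_le : ∀ e ∈ J, ∀ e' ∈ J, k e ≤ k e' → c e ≤ c e'
  swap_lt : ∀ e ∈ J, ∀ f ∈ U, ∀ e' ∈ J, ∀ f' ∈ U, swapCost c (e, f) < swapCost c (e', f') →
    k f - k e < k f' - k e'
  swap_lt_of_idx : ∀ e ∈ J, ∀ f ∈ U, ∀ e' ∈ J, ∀ f' ∈ U,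
    swapCost c (e, f) = swapCost c (e', f') → idx f < idx f' → k f - k e < k f' - k e'

lemma exists_isKey {c b idx : α → ℕ} {N : Matroid α} {J U : Finset α} {T : List (α × α)}
    (hT : SSGReturns c b idx N J U T) (hp : IsBasePair b N J U)
    (hidx : ∀ f ∈ U, ∀ g ∈ U, idx f < idx g → c f ≤ c g) : ∃ k, IsKey c idx k J U T := by
  set L := T.map Prod.fst with hL
  have hLlen : L.length = T.length := by rw [hL, List.length_map]
  have hnodup : L.Nodup := by
    have := J.nodup
    rwa [← hT.map_fst] at this
  have hpos : ∀ e ∈ J, L.idxOf e < T.length := fun e he => by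
    rw [← hLlen, List.idxOf_lt_length_iff, ← Multiset.mem_coe, hL, hT.map_fst]
    exact he
  -- Remainders `n * idx f + pos e` of swap keys modulo `a` are less than `a`, and positions in `T`
  -- are less than `n`.
  set n : ℤ := T.length + 1 with hn
  set m : ℤ := U.sup idx + 1 with hm
  set a : ℤ := n * m with ha
  have hn0 : 0 < n := by positivity
  have hm1 : 1 ≤ m := by omega
  have han : n ≤ a := by nlinarith
  have hia : ∀ f ∈ U, n * idx f + n ≤ a := fun f hf => by
    have : idx f ≤ U.sup idx := Finset.le_sup hf
    have : (idx f : ℤ) + 1 ≤ m := by omega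
    nlinarith
  set k : α → ℤ := fun y => if b y = 0 then a * c y + n * idx y else a * c y - L.idxOf y with hk
  have hkr : ∀ e ∈ J, k e = a * c e - L.idxOf e := fun e he => by
    simp [hk, hp.red e he]
  have hkg : ∀ f ∈ U, k f = a * c f + n * idx f := fun f hf => by
    simp [hk, hp.green f hf]
  have hmul : ∀ {x y : ℤ}, x < y → a * x + a ≤ a * y := fun {x y} h => by
    have : a * (x + 1) ≤ a * y := mul_le_mul_of_nonneg_left h (by omega)
    linarith
  have hidx0 : ∀ f, 0 ≤ n * (idx f : ℤ) := fun f => by positivity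
  have hred : ∀ e ∈ J, ∀ e' ∈ J, c e < c e' → k e < k e' := by
    intro e he e' he' h
    have h1 := hmul (x := c e) (y := c e') (by exact_mod_cast h)
    have h2 := hpos e' he'
    rw [hkr e he, hkr e' he']
    omega
  have hgreen : ∀ f ∈ U, ∀ g ∈ U, c f < c g → k f < k g := by
    intro f hf g hg h
    have h1 := hmul (x := c f) (y := c g) (by exact_mod_cast h)
    have h2 := hia f hf
    have h3 := hidx0 g
    rw [hkg f hf, hkg g hg]
    linarith
  have hidxmul : ∀ {f g}, idx f < idx g → n * (idx f : ℤ) + n ≤ n * idx g := fun {f g} h => by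
    have h' : (idx f : ℤ) + 1 ≤ idx g := by exact_mod_cast h
    have := mul_le_mul_of_nonneg_left h' hn0.le
    linarith
  refine ⟨k, ?_, ?_, ?_, ?_, ?_, ?_⟩
  · refine List.pairwise_iff_getElem.2 fun i j hi hj hij => ?_
    have hmem : ∀ (i : ℕ) (hi : i < T.length), T[i].1 ∈ J := fun i hi =>
      hT.fst_mem.2 ⟨_, List.getElem_mem hi, rfl⟩
    refine ⟨fun h => ?_, fun h => hred _ (hmem i hi) _ (hmem j hj) h⟩
    rcases h.lt_or_eq with h | h
    · exact hred _ (hmem j hj) _ (hmem i hi) h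
    · have hidxOf : ∀ (i : ℕ) (hi : i < T.length), L.idxOf T[i].1 = i := fun i hi => by
        have := hnodup.idxOf_getElem i (by rw [hLlen]; exact hi)
        simpa [hL] using this
      rw [hkr _ (hmem j hj), hkr _ (hmem i hi), hidxOf i hi, hidxOf j hj, h]
      omega
  · intro f hf g hg h
    rcases (hidx f hf g hg h).lt_or_eq with h' | h'
    · exact hgreen f hf g hg h'
    · have := hidxmul h
      rw [hkg f hf, hkg g hg, h']
      linarith
  · intro f hf g hg h
    by_contra! hlt
    exact absurd (hgreen g hg f hf hlt) (not_lt.2 h)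
  · intro e he e' he' h
    by_contra! hlt
    exact absurd (hred e' he' e he hlt) (not_lt.2 h)
  · intro e he f hf e' he' f' hf' h
    have h1 := hmul h
    have h2 := hia f hf
    have h3 := hidx0 f'
    have h4 := hpos e he
    simp only [swapCost, mul_sub] at h1
    rw [hkr e he, hkr e' he', hkg f hf, hkg f' hf']
    omega
  · intro e he f hf e' he' f' hf' h hlt
    have h1 := congrArg (a * ·) h
    have h2 := hidxmul hlt
    have h4 := hpos e he
    simp only [swapCost, mul_sub] at h1
    rw [hkr e he, hkr e' he', hkg f hf, hkg f' hf']
    omega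

/-! ### The sequence of bases -/

/-- The bases visited from `B` on when the swaps of the list are performed. -/
def visited : List (α × α) → Finset α → Set (Finset α)
  | [], B => {B}
  | s :: S, B => insert B (visited S (exchange B s.1 s.2))

/-- A sequence of swaps of positive cost such that each visited basis has minimal cost `c` among
the bases with the same value of `b`, and the last one has minimal `b`. -/
def IsParetoChain (M : Matroid α) (c b : α → ℕ) : List (α × α) → Finset α → Prop
  | [], B => B ∈ bases M ∧ ∀ B' ∈ bases M,
      cost b B ≤ cost b B' ∧ (cost b B' = cost b B → cost c B ≤ cost c B')
  | s :: S, B => B ∈ bases M ∧ (∀ B' ∈ bases M, cost b B' = cost b B → cost c B ≤ cost c B') ∧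
      IsSwap M b B s ∧ 0 < swapCost c s ∧ IsParetoChain M c b S (exchange B s.1 s.2)

lemma IsSwap.cost_b {M : Matroid α} {b : α → ℕ} {B : Finset α} {s : α × α} (h : IsSwap M b B s) :
    (cost b (exchange B s.1 s.2) : ℤ) = cost b B - 1 := by
  have := cost_exchange b h.1 h.2.2.1
  rw [this, h.2.1, h.2.2.2.1]
  push_cast
  ring

lemma IsSwap.cost_c {M : Matroid α} {b : α → ℕ} (c : α → ℕ) {B : Finset α} {s : α × α}
    (h : IsSwap M b B s) : (cost c (exchange B s.1 s.2) : ℤ) = cost c B + swapCost c s :=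
  cost_exchange c h.1 h.2.2.1

namespace IsParetoChain

variable {M : Matroid α} {c b : α → ℕ} {S : List (α × α)} {B : Finset α}

lemma mem_bases (h : IsParetoChain M c b S B) : B ∈ bases M := by
  cases S <;> exact h.1

/-- Along the chain `b` decreases and `c` increases. -/
lemma of_mem_visited (h : IsParetoChain M c b S B) {D : Finset α} (hD : D ∈ visited S B) :
    D ∈ bases M ∧ (D = B ∨ cost b D < cost b B ∧ cost c B < cost c D) := by
  induction S generalizing B with
  | nil =>
    obtain rfl : D = B := hD
    exact ⟨h.1, Or.inl rfl⟩
  | cons s S ih =>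
    obtain ⟨hB, -, hs, hpos, hS⟩ := h
    rcases hD with rfl | hD
    · exact ⟨hB, Or.inl rfl⟩
    · obtain ⟨h1, h2⟩ := ih hS hD
      have hb := hs.cost_b
      have hc := hs.cost_c c
      refine ⟨h1, Or.inr ?_⟩
      rcases h2 with rfl | h2 <;> omega

/-- Every basis with at most the initial value of `b` is matched by a visited one with the same value
of `b` that is not more expensive. -/
lemma exists_le (h : IsParetoChain M c b S B) {B' : Finset α} (hB' : B' ∈ bases M)
    (hle : cost b B' ≤ cost b B) :
    ∃ D ∈ visited S B, cost b D = cost b B' ∧ cost c D ≤ cost c B' := by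
  induction S generalizing B with
  | nil =>
    have heq := le_antisymm hle (h.2 B' hB').1
    exact ⟨B, rfl, heq.symm, (h.2 B' hB').2 heq⟩
  | cons s S ih =>
    obtain ⟨hB, hmin, hs, -, hS⟩ := h
    rcases hle.lt_or_eq with hlt | heq
    · have hb := hs.cost_b
      obtain ⟨D, hD, hD'⟩ := ih hS (by omega)
      exact ⟨D, Or.inr hD, hD'⟩
    · exact ⟨B, Or.inl rfl, heq.symm, hmin B' hB' heq⟩

lemma trichotomy (h : IsParetoChain M c b S B) {D D' : Finset α} (hD : D ∈ visited S B)
    (hD' : D' ∈ visited S B) : D = D' ∨ (cost b D < cost b D' ∧ cost c D' < cost c D) ∨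
      (cost b D' < cost b D ∧ cost c D < cost c D') := by
  induction S generalizing B with
  | nil =>
    obtain rfl : D = B := hD
    obtain rfl : D' = D := hD'
    exact Or.inl rfl
  | cons s S ih =>
    have hB₁ := fun {D} => h.of_mem_visited (D := D)
    rcases hD with rfl | hD <;> rcases hD' with rfl | hD'
    · exact Or.inl rfl
    · rcases (hB₁ (Or.inr hD')).2 with h' | h'
      · exact Or.inl h'.symm
      · exact Or.inr (Or.inr h')
    · rcases (hB₁ (Or.inr hD)).2 with h' | h'
      · exact Or.inl h'
      · exact Or.inr (Or.inl h')
    · exact ih h.2.2.2.2 hD hD'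

lemma visited_subset_efficientSet (h : IsParetoChain M c b S B) :
    visited S B ⊆ efficientSet M c b := by
  intro D hD
  refine ⟨(h.of_mem_visited hD).1, ?_⟩
  rintro ⟨B', hB', hc, hb, hne⟩
  simp only [outcome, Nat.cast_le] at hc hb
  have hDB : cost b D ≤ cost b B := by
    rcases (h.of_mem_visited hD).2 with rfl | h'
    · exact le_rfl
    · exact h'.1.le
  obtain ⟨D', hD', hD'b, hD'c⟩ := h.exists_le hB' (hb.trans hDB)
  rcases h.trichotomy hD hD' with rfl | h' | h'
  · exact hne (by rw [outcome, outcome, hD'b, le_antisymm hD'c hc])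
  · omega
  · omega

lemma image_visited (h : IsParetoChain M c b S B) (hB : IsLexOptimal M c b B) :
    outcome c b '' visited S B = nondominatedSet M c b := by
  refine (Set.image_mono h.visited_subset_efficientSet).antisymm ?_
  rintro _ ⟨B', ⟨hB', hnot⟩, rfl⟩
  obtain ⟨D, hD, hbD, hcD⟩ : ∃ D ∈ bases M, cost b D ≤ cost b B' ∧ cost c D ≤ cost c B' ∧
      (D ∈ visited S B ∨ cost b D ≠ cost b B') := by
    rcases le_or_gt (cost b B') (cost b B) with hle | hlt
    · obtain ⟨D, hD, h1, h2⟩ := h.exists_le hB' hle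
      exact ⟨D, (h.of_mem_visited hD).1, h1.le, h2, Or.inl hD⟩
    · refine ⟨B, h.mem_bases, hlt.le, ?_, Or.inr hlt.ne⟩
      rcases hB.2 B' hB' with h' | h'
      · exact h'.le
      · exact h'.1.le
  by_cases heq : outcome c b D = outcome c b B'
  · refine ⟨D, hcD.2.resolve_right fun hne => hne ?_, heq⟩
    simpa [outcome] using congrArg Prod.snd heq
  · exact absurd ⟨D, hD, by simpa [outcome] using hcD.1, by simpa [outcome] using hbD, heq⟩ hnot

lemma isMinimalCompleteSet (h : IsParetoChain M c b S B) (hB : IsLexOptimal M c b B) :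
    IsMinimalCompleteSet M c b (visited S B) := by
  refine ⟨h.visited_subset_efficientSet, h.image_visited hB, ?_⟩
  rw [← h.image_visited hB, Set.InjOn.encard_image]
  intro D hD D' hD' heq
  have h1 : cost b D = cost b D' := by
    simpa [outcome] using congrArg Prod.snd heq
  rcases h.trichotomy hD hD' with h' | h' | h'
  · exact h'
  · omega
  · omega

lemma loop_eq (h : IsParetoChain M c b S B) (X : Set (Finset α)) (Y : Set (ℤ × ℤ)) (hX : B ∈ X)
    (hY : outcome c b B ∈ Y) : loop c S B (cost c B) (cost b B) X Y =
      (X ∪ visited S B, Y ∪ outcome c b '' visited S B) := by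
  induction S generalizing B X Y with
  | nil => simp [loop, visited, hX, hY]
  | cons s S ih =>
    obtain ⟨-, -, hs, -, hS⟩ := h
    rw [loop, ← hs.cost_b, ← hs.cost_c c, ih hS _ _ (Or.inr rfl) (Or.inr rfl)]
    have hmem : exchange B s.1 s.2 ∈ visited S (exchange B s.1 s.2) := by
      cases S
      · exact rfl
      · exact Or.inl rfl
    rw [visited, Set.image_insert_eq]
    ext x
    · simp only [Set.mem_union, Set.mem_singleton_iff, Set.mem_insert_iff]
      constructor
      · rintro ((h | rfl) | h)
        · exact Or.inl h
        · exact Or.inr (Or.inr hmem)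
        · exact Or.inr (Or.inr h)
      · rintro (h | rfl | h)
        · exact Or.inl (Or.inl h)
        · exact Or.inl (Or.inl hX)
        · exact Or.inr h
    · simp only [Set.mem_union, Set.mem_singleton_iff, Set.mem_insert_iff]
      constructor
      · rintro ((h | rfl) | h)
        · exact Or.inl h
        · exact Or.inr (Or.inr ⟨_, hmem, rfl⟩)
        · exact Or.inr (Or.inr h)
      · rintro (h | rfl | h)
        · exact Or.inl (Or.inl h)
        · exact Or.inl (Or.inl hY)
        · exact Or.inr h

lemma output_eq (h : IsParetoChain M c b S B) :
    output c b B S = (visited S B, outcome c b '' visited S B) := by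
  have hmem : B ∈ visited S B := by
    cases S
    · exact rfl
    · exact Or.inl rfl
  rw [output, ← outcome, h.loop_eq _ _ (Set.mem_singleton _) (Set.mem_singleton _),
    Set.union_eq_right.2 (Set.singleton_subset_iff.2 hmem),
    Set.union_eq_right.2 (Set.singleton_subset_iff.2 (Set.mem_image_of_mem _ hmem))]

end IsParetoChain

end BasisSequence

section SortedSwaps

variable {α : Type*}

/-! ### Correctness of the sorted sequence of swaps -/

lemma exists_isSorted_perm (c idx : α → ℕ) (T : List (α × α)) :
    ∃ S, S.Perm T ∧ IsSorted c idx S := by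
  let r : α × α → α × α → Prop := fun s t =>
    swapCost c s < swapCost c t ∨ (swapCost c s = swapCost c t ∧ idx s.2 ≤ idx t.2)
  have : DecidableRel r := fun _ _ => Classical.dec _
  have : Std.Total r := ⟨fun s t => by simp only [r]; omega⟩
  have : IsTrans (α × α) r := ⟨fun s t u h h' => by simp only [r] at *; omega⟩
  exact ⟨T.insertionSort r, List.perm_insertionSort r T, List.pairwise_insertionSort r T⟩

variable [DecidableEq α]

/-- The set in which the swaps of `P` have been performed and those of `Q` have not, where `C` is
the set of elements on which no swap acts. -/
def partialSet (C : Finset α) (P Q : List (α × α)) : Finset α :=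
  (P.map Prod.snd ++ Q.map Prod.fst).toFinset ∪ C

lemma stage_eq_of_pairwise {k : α → ℤ} {P Q : List (α × α)} {s : α × α}
    (h : (P ++ s :: Q).Pairwise fun s t => k s.2 - k s.1 < k t.2 - k t.1) :
    stage k (k s.2 - k s.1 - 1) (P ++ s :: Q) =
      (P.map Prod.snd ++ (s :: Q).map Prod.fst).toFinset := by
  obtain ⟨-, hQ, hPQ⟩ := List.pairwise_append.1 h
  have hP : P.map (fun u => if k u.2 - k u.1 ≤ k s.2 - k s.1 - 1 then u.2 else u.1) =
      P.map Prod.snd := by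
    refine List.map_congr_left fun u hu => if_pos ?_
    have := hPQ u hu s (List.mem_cons_self ..)
    omega
  have hQ' : (s :: Q).map (fun u => if k u.2 - k u.1 ≤ k s.2 - k s.1 - 1 then u.2 else u.1) =
      (s :: Q).map Prod.fst := by
    refine List.map_congr_left fun u hu => if_neg ?_
    rcases List.mem_cons.1 hu with rfl | hu
    · omega
    · have := (List.pairwise_cons.1 hQ).1 u hu
      omega
  rw [stage, List.map_append, hP, hQ']

section Run

variable {M : Matroid α} {c b idx : α → ℕ} {Bj Bu : Finset α} {S T : List (α × α)}

lemma exists_isKey_of_run (hb : ∀ e ∈ M.E, b e = 0 ∨ b e = 1) (hidx : IsGreenIndexing M c b idx)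
    (hj : IsLexOptimal M c b Bj) (hu : IsTarget M c b Bj Bu)
    (hT : SSGReturns c b idx (reduced M Bj Bu) (Bj \ Bu) (Bu \ Bj) T) :
    ∃ k, IsKey c idx k (Bj \ Bu) (Bu \ Bj) T := by
  have hp := hu.isBasePair hb hj
  have huE := (hu.1.1 : M.IsBase _).subset_ground
  exact exists_isKey hT hp fun f hf g hg h =>
    hidx.sorted f (huE (Finset.mem_sdiff.1 hf).1) g (huE (Finset.mem_sdiff.1 hg).1)
      (hp.green f hf) (hp.green g hg) h

lemma IsKey.pairwise_lt {N : Matroid α} {J U : Finset α} {k : α → ℤ} (hk : IsKey c idx k J U T)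
    (hT : SSGReturns c b idx N J U T) (hidx : Set.InjOn idx (U : Set α)) (hperm : S.Perm T)
    (hS : IsSorted c idx S) : S.Pairwise fun s t => k s.2 - k s.1 < k t.2 - k t.1 := by
  have hnodup : (S.map Prod.snd).Nodup := by
    have := U.nodup
    rw [← hT.map_snd] at this
    exact (hperm.map Prod.snd).nodup_iff.2 this
  have hfst : ∀ s ∈ S, s.1 ∈ J := fun s hs => hT.fst_mem.2 ⟨s, hperm.mem_iff.1 hs, rfl⟩
  have hsnd : ∀ s ∈ S, s.2 ∈ U := fun s hs => hT.snd_mem.2 ⟨s, hperm.mem_iff.1 hs, rfl⟩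
  refine (hS.and (List.pairwise_map.1 hnodup)).imp_of_mem fun {s t} hs ht h => ?_
  obtain ⟨h | ⟨h, hle⟩, hne⟩ := h
  · exact hk.swap_lt _ (hfst s hs) _ (hsnd s hs) _ (hfst t ht) _ (hsnd t ht) h
  · refine hk.swap_lt_of_idx _ (hfst s hs) _ (hsnd s hs) _ (hfst t ht) _ (hsnd t ht) h
      (lt_of_le_of_ne hle fun heq => hne (hidx (hsnd s hs) (hsnd t ht) heq))

/-- The set reached before the swap `s` is a greedy basis of the reduced matroid for the
scalarization `c + l * b`, where `l` is the cost of `s`. -/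
lemma IsKey.isGreedy_before {k : α → ℤ} {N : Matroid α} {J U : Finset α}
    (hk : IsKey c idx k J U T) (hp : IsBasePair b N J U) (hT : SSGReturns c b idx N J U T)
    (hperm : S.Perm T) (hlt : S.Pairwise fun s t => k s.2 - k s.1 < k t.2 - k t.1)
    {P Q : List (α × α)} {s : α × α} (hPQ : S = P ++ s :: Q) :
    IsGreedy N (lagrangian c b (swapCost c s))
      ((P.map Prod.snd ++ (s :: Q).map Prod.fst).toFinset : Finset α) := by
  have hg := hT.isGreedy_stage hp hk.refinesRed hk.green_lt (k s.2 - k s.1 - 1)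
  have hst : stage k (k s.2 - k s.1 - 1) T = stage k (k s.2 - k s.1 - 1) S :=
    List.toFinset_eq_of_perm _ _ (hperm.symm.map _)
  rw [hst, hPQ, stage_eq_of_pairwise (hPQ ▸ hlt)] at hg
  have hsT : s ∈ T := hperm.mem_iff.1 (by simp [hPQ])
  have hs1 : s.1 ∈ J := hT.fst_mem.2 ⟨s, hsT, rfl⟩
  have hs2 : s.2 ∈ U := hT.snd_mem.2 ⟨s, hsT, rfl⟩
  have hr : ∀ e ∈ J, shiftedKey b k (k s.2 - k s.1 - 1) e =
      2 * k e + 2 * (k s.2 - k s.1 - 1) + 1 ∧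
      lagrangian c b (swapCost c s) e = c e + swapCost c s := fun e he => by
    simp [shiftedKey, lagrangian, hp.red e he]
  have hgr : ∀ f ∈ U, shiftedKey b k (k s.2 - k s.1 - 1) f = 2 * k f ∧
      lagrangian c b (swapCost c s) f = c f := fun f hf => by
    simp [shiftedKey, lagrangian, hp.green f hf]
  refine hg.mono fun z hz y hy hzy => ?_
  rw [hp.ground_eq] at hz hy
  rcases hz with hz | hz <;> rcases hy with hy | hy
  · rw [(hr z hz).1, (hr y hy).1] at hzy
    rw [(hr z hz).2, (hr y hy).2]
    have := hk.red_le z hz y hy (by omega)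
    omega
  · rw [(hr z hz).1, (hgr y hy).1] at hzy
    rw [(hr z hz).2, (hgr y hy).2]
    by_contra! hcon
    have := hk.swap_lt z hz y hy s.1 hs1 s.2 hs2 (by
      simp only [swapCost] at hcon ⊢
      omega)
    omega
  · rw [(hgr z hz).1, (hr y hy).1] at hzy
    rw [(hgr z hz).2, (hr y hy).2]
    by_contra! hcon
    have := hk.swap_lt s.1 hs1 s.2 hs2 y hy z hz (by
      simp only [swapCost] at hcon ⊢
      omega)
    omega
  · rw [(hgr z hz).1, (hgr y hy).1] at hzy
    rw [(hgr z hz).2, (hgr y hy).2]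
    have := hk.green_le z hz y hy (by omega)
    omega

/-- Every set reached in the final loop is a basis, and the swap performed next is minimal: the
basis is greedy for `c + l * b` with `l` the cost of that swap. Lexicographic optimality of `Bj`
makes the first swap, and hence all swaps, have positive cost. -/
theorem Run.chain (hb : ∀ e ∈ M.E, b e = 0 ∨ b e = 1) (hidx : IsGreenIndexing M c b idx)
    (h : Run M c b idx Bj Bu S) : IsSwapSequence M c b Bj S Bu ∧ IsParetoChain M c b S Bj := by
  obtain ⟨hj, hu, T, hT, hperm, hS⟩ := h
  obtain ⟨k, hk⟩ := exists_isKey_of_run hb hidx hj hu hT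
  have hp := hu.isBasePair hb hj
  have huE := (hu.1.1 : M.IsBase _).subset_ground
  have hU : ((Bu \ Bj : Finset α) : Set α) ⊆ {f | f ∈ M.E ∧ b f = 0} :=
    fun f hf => ⟨huE (Finset.mem_sdiff.1 hf).1, hp.green f hf⟩
  have hlt := hk.pairwise_lt hT (hidx.injOn.mono hU) hperm hS
  have hgN : ∀ P Q s, S = P ++ s :: Q → IsGreedy (reduced M Bj Bu)
      (lagrangian c b (swapCost c s))
      ((P.map Prod.snd ++ (s :: Q).map Prod.fst).toFinset : Finset α) :=
    fun P Q s => hk.isGreedy_before hp hT hperm hlt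
  have hmem1 : ∀ e, e ∈ Bj \ Bu ↔ ∃ s ∈ S, s.1 = e := fun e => by
    rw [hT.fst_mem]
    simp only [hperm.mem_iff]
  have hmem2 : ∀ f, f ∈ Bu \ Bj ↔ ∃ s ∈ S, s.2 = f := fun f => by
    rw [hT.snd_mem]
    simp only [hperm.mem_iff]
  have hnodup1 : (S.map Prod.fst).Nodup := by
    have := (Bj \ Bu).nodup
    rw [← hT.map_fst] at this
    exact (hperm.map Prod.fst).nodup_iff.2 this
  have hnodup2 : (S.map Prod.snd).Nodup := by
    have := (Bu \ Bj).nodup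
    rw [← hT.map_snd] at this
    exact (hperm.map Prod.snd).nodup_iff.2 this
  have hfirst : partialSet (Bj ∩ Bu) [] S = Bj := by
    ext x
    have := hmem1 x
    simp only [partialSet, List.map_nil, List.nil_append, Finset.mem_union, List.mem_toFinset,
      List.mem_map, Finset.mem_inter]
    rw [← this, Finset.mem_sdiff]
    tauto
  have hlast : partialSet (Bj ∩ Bu) S [] = Bu := by
    ext x
    have := hmem2 x
    simp only [partialSet, List.map_nil, List.append_nil, Finset.mem_union, List.mem_toFinset,
      List.mem_map, Finset.mem_inter]
    rw [← this, Finset.mem_sdiff]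
    tauto
  have hbase : ∀ P Q, S = P ++ Q → partialSet (Bj ∩ Bu) P Q ∈ bases M := by
    intro P Q hPQ
    cases Q with
    | nil =>
      rw [List.append_nil] at hPQ
      rw [← hPQ, hlast]
      exact hu.1.1
    | cons s Q =>
      have := ((reduced_isBase_iff hj.1).1 (hgN P Q s hPQ).1).1
      rw [← Finset.coe_inter, ← Finset.coe_union] at this
      exact this
  have hswap : ∀ P Q s, S = P ++ s :: Q → IsSwap M b (partialSet (Bj ∩ Bu) P (s :: Q)) s ∧
      exchange (partialSet (Bj ∩ Bu) P (s :: Q)) s.1 s.2 = partialSet (Bj ∩ Bu) (P ++ [s]) Q := by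
    intro P Q s hPQ
    have hsS : s ∈ S := by simp [hPQ]
    have hs1 := (hmem1 s.1).2 ⟨s, hsS, rfl⟩
    have hs2 := (hmem2 s.2).2 ⟨s, hsS, rfl⟩
    have hP2 : ∀ u ∈ P, u.2 ∈ Bu \ Bj := fun u hu' => (hmem2 _).2 ⟨u, by simp [hPQ, hu'], rfl⟩
    have hQ1 : ∀ u ∈ Q, u.1 ∈ Bj \ Bu := fun u hu' => (hmem1 _).2 ⟨u, by simp [hPQ, hu'], rfl⟩
    have hn1 : ∀ u ∈ Q, u.1 ≠ s.1 := by
      rw [hPQ, List.map_append, List.map_cons] at hnodup1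
      have := (List.nodup_cons.1 (List.nodup_append.1 hnodup1).2.1).1
      intro u hu' heq
      exact this (List.mem_map.2 ⟨u, hu', heq⟩)
    have hn2 : ∀ u ∈ P, u.2 ≠ s.2 := by
      rw [hPQ, List.map_append, List.map_cons] at hnodup2
      have := (List.nodup_append.1 hnodup2).2.2
      exact fun u hu' => this _ (List.mem_map.2 ⟨u, hu', rfl⟩) _ (List.mem_cons_self ..)
    rw [Finset.mem_sdiff] at hs1 hs2
    simp only [Finset.mem_sdiff] at hP2 hQ1
    have hmem : ∀ P Q x, x ∈ partialSet (Bj ∩ Bu) P Q ↔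
        (∃ u ∈ P, u.2 = x) ∨ (∃ u ∈ Q, u.1 = x) ∨ (x ∈ Bj ∧ x ∈ Bu) := fun P Q x => by
      simp only [partialSet, Finset.mem_union, List.mem_toFinset, List.mem_append, List.mem_map,
        Finset.mem_inter, or_assoc]
    have hex : exchange (partialSet (Bj ∩ Bu) P (s :: Q)) s.1 s.2 =
        partialSet (Bj ∩ Bu) (P ++ [s]) Q := by
      ext x
      rw [exchange, Finset.mem_insert, Finset.mem_erase, hmem, hmem]
      constructor
      · rintro (rfl | ⟨hx, ⟨u, hu', rfl⟩ | ⟨u, hu', rfl⟩ | hx'⟩)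
        · exact Or.inl ⟨s, by simp, rfl⟩
        · exact Or.inl ⟨u, by simp [hu'], rfl⟩
        · rcases List.mem_cons.1 hu' with rfl | hu'
          · exact absurd rfl hx
          · exact Or.inr (Or.inl ⟨u, hu', rfl⟩)
        · exact Or.inr (Or.inr hx')
      · rintro (⟨u, hu', rfl⟩ | ⟨u, hu', rfl⟩ | hx')
        · rcases List.mem_append.1 hu' with hu' | hu'
          · refine Or.inr ⟨fun heq => ?_, Or.inl ⟨u, hu', rfl⟩⟩
            exact (hP2 u hu').2 (heq ▸ hs1.1)
          · rw [List.mem_singleton.1 hu']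
            exact Or.inl rfl
        · exact Or.inr ⟨hn1 u hu', Or.inr (Or.inl ⟨u, List.mem_cons_of_mem _ hu', rfl⟩)⟩
        · exact Or.inr ⟨fun heq => hs1.2 (heq ▸ hx'.2), Or.inr (Or.inr hx')⟩
    refine ⟨⟨?_, hp.red _ (Finset.mem_sdiff.2 hs1), ?_, hp.green _ (Finset.mem_sdiff.2 hs2), ?_⟩,
      hex⟩
    · exact (hmem _ _ _).2 (Or.inr (Or.inl ⟨s, List.mem_cons_self .., rfl⟩))
    · rw [hmem]
      rintro (⟨u, hu', heq⟩ | ⟨u, hu', heq⟩ | hx)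
      · exact hn2 u hu' heq
      · rcases List.mem_cons.1 hu' with rfl | hu'
        · exact hs1.2 (heq ▸ hs2.1)
        · exact (hQ1 u hu').2 (heq ▸ hs2.1)
      · exact hs2.2 hx.1
    · rw [hex]
      exact hbase _ _ (by rw [hPQ, List.append_assoc]; rfl)
  have hpos : ∀ s ∈ S, 0 < swapCost c s := by
    cases S with
    | nil => simp
    | cons s Q =>
      have hs : 0 < swapCost c s := by
        have h1 := (hswap [] Q s rfl).1
        rw [hfirst] at h1
        have hb1 := h1.cost_b
        have hc1 := h1.cost_c c
        have := hj.2 _ h1.2.2.2.2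
        omega
      intro u hu'
      rcases List.mem_cons.1 hu' with rfl | hu'
      · exact hs
      · have := (List.pairwise_cons.1 hS).1 u hu'
        omega
  have hgM : ∀ P Q s, S = P ++ s :: Q → IsGreedy M (lagrangian c b (swapCost c s))
      (partialSet (Bj ∩ Bu) P (s :: Q) : Finset α) := fun P Q s hPQ =>
    hu.isGreedy_union hb hj (hpos s (by simp [hPQ])).le (hgN P Q s hPQ)
  have main : ∀ Q P, S = P ++ Q → IsSwapSequence M c b (partialSet (Bj ∩ Bu) P Q) Q Bu ∧
      IsParetoChain M c b Q (partialSet (Bj ∩ Bu) P Q) := by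
    intro Q
    induction Q with
    | nil =>
      intro P hPQ
      rw [List.append_nil] at hPQ
      rw [← hPQ, hlast]
      exact ⟨rfl, hu.1.1, fun B' hB' => hu.isMin hb hj hB'⟩
    | cons s Q ih =>
      intro P hPQ
      obtain ⟨hsw, hex⟩ := hswap P Q s hPQ
      have hih := ih (P ++ [s]) (by rw [hPQ, List.append_assoc]; rfl)
      rw [← hex] at hih
      have hg := hgM P Q s hPQ
      refine ⟨⟨⟨hsw, fun t ht => ?_⟩, hih.1⟩, hbase _ _ hPQ, fun B' hB' heq => ?_, hsw,
        hpos s (by simp [hPQ]), hih.2⟩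
      · have hle := hg.lagrangian_le ht.2.2.2.2
        rw [ht.cost_b, ht.cost_c c] at hle
        linarith
      · have hle := hg.lagrangian_le hB'
        rw [heq] at hle
        omega
  have := main S [] rfl
  rwa [hfirst] at this

end Run

end SortedSwaps

end ESA

theorem mainTheorem6 {α : Type*} [DecidableEq α] (M : Matroid α) [M.Finite]
    (c b : α → ℕ) (hb : ∀ e ∈ M.E, b e = 0 ∨ b e = 1)
    (idx : α → ℕ) (hidx : ESA.IsGreenIndexing M c b idx) :
    ESA.Terminates M c b idx ∧
    (∃ X Y, ESA.Returns M c b idx X Y) ∧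
    (∀ Bj Bu S, ESA.Run M c b idx Bj Bu S → ESA.IsSwapSequence M c b Bj S Bu) ∧
    (∀ X Y, ESA.Returns M c b idx X Y →
      Y = ESA.nondominatedSet M c b ∧ ESA.IsMinimalCompleteSet M c b X) := by
  have hterm : ESA.Terminates M c b idx := by
    refine ⟨ESA.exists_isLexOptimal M c b, fun Bj hj =>
      ⟨ESA.exists_isTarget M hj.1, fun Bu hu => ?_⟩⟩
    have hp := hu.isBasePair hb hj
    have hU : ((Bu \ Bj : Finset α) : Set α) ⊆ {f | f ∈ M.E ∧ b f = 0} := fun f hf =>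
      ⟨(hu.1.1 : M.IsBase _).subset_ground (Finset.mem_sdiff.1 hf).1, hp.green f hf⟩
    exact hp.ssgTerminates (hidx.injOn.mono hU)
  refine ⟨hterm, ?_, fun Bj Bu S h => (h.chain hb hidx).1, ?_⟩
  · obtain ⟨Bj, hj⟩ := hterm.1
    obtain ⟨Bu, hu⟩ := (hterm.2 Bj hj).1
    obtain ⟨T, hT⟩ := ((hterm.2 Bj hj).2 Bu hu).exists_returns
    obtain ⟨S, hST, hS⟩ := ESA.exists_isSorted_perm c idx T
    exact ⟨_, _, Bj, Bu, S, ⟨hj, hu, T, hT, hST, hS⟩, rfl⟩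
  · rintro X Y ⟨Bj, Bu, S, hrun, hout⟩
    have hchain := (hrun.chain hb hidx).2
    rw [hchain.output_eq, Prod.mk.injEq] at hout
    obtain ⟨rfl, rfl⟩ := hout
    exact ⟨hchain.image_visited hrun.1, hchain.isMinimalCompleteSet hrun.1⟩
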